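/- Let $n,k\ge 1$ be integers, let $V,W$ be finite-dimensional real inner product spaces, and let $\mathbb{B}(D)=\sum_{|\alpha|=k}\mathbb{B}_\alpha\partial^\alpha$, with $\mathbb{B}_\alpha\in\operatorname{Lin}(V,W)$, be a $k$-homogeneous linear differential operator with constant coefficients on $\mathbb{R}^n$ from $V$ to $W$, with symbol $\mathbb{B}(\xi)=\sum_{|\alpha|=k}\xi^\alpha\mathbb{B}_\alpha$. Assume that $\mathbb{B}(D)$ has constant rank, i.e. there is an integer $r$ such that $\operatorname{rank}\mathbb{B}(\xi)=r$ for all $0\ne\xi\in\mathbb{R}^n$. Then $\mathbb{B}(D)$ is canceling, i.e. $\bigcap_{\xi\in\mathbb{S}^{n-1}}\operatorname{im}\mathbb{B}(\xi)=\{0\}$, if and only if for all $u\in L^1_{\mathrm{loc}}(\mathbb{R}^n,V)$ and $w\in W$, $$\mathbb{B}(D)u=\delta_0 w\ \text{ in the sense of distributions on }\mathbb{R}^n\quad\Longrightarrow\quad w=0.$$ Moreover, if $\mathbb{B}(D)$ is not canceling, then for every nonzero $w\in\bigcap_{\xi\in\mathbb{S}^{n-1}}\operatorname{im}\mathbb{B}(\xi)$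 there is $u_h\in L^1_{\mathrm{loc}}(\mathbb{R}^n,V)\cap C^\infty(\mathbb{R}^n\setminus\{0\},V)$ with $\mathbb{B}(D)u_h=\delta_0 w$ in the sense of distributions on $\mathbb{R}^n$, such that for every integer $l\ge\max\{0,k-n+1\}$ the derivative $D^l u_h$ is $(k-n-l)$-homogeneous on $\mathbb{R}^n\setminus\{0\}$, i.e. $D^lu_h(tx)=t^{k-n-l}D^lu_h(x)$ for all $x\ne0$ and $t>0$. -/

import Mathlib

open MeasureTheory
open scoped Distributions LineDeriv ContDiff

noncomputable section

namespace ConstRank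

/-- `ℝⁿ` with its Euclidean norm. -/
abbrev Rn (n : ℕ) : Type := EuclideanSpace ℝ (Fin n)

/-- The multi-indices `α ∈ ℕⁿ` of length `|α| = k`. -/
abbrev multiIndices (n k : ℕ) : Finset (Fin n → ℕ) := Finset.piAntidiag Finset.univ k

section Distributions

variable {n : ℕ} {V W : Type*} [NormedAddCommGroup V] [NormedSpace ℝ V]
  [NormedAddCommGroup W] [NormedSpace ℝ W]

/-- `∂^α T = ∂₁^{α₁} ⋯ ∂ₙ^{αₙ} T` for a distribution `T` on `ℝⁿ`. -/
def partialDeriv (α : Fin n → ℕ) (T : 𝓓'((⊤ : TopologicalSpace.Opens (Rn n)), V)) :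
    𝓓'((⊤ : TopologicalSpace.Opens (Rn n)), V) :=
  (List.finRange n).foldr (fun i S => (∂_{EuclideanSpace.single i (1 : ℝ)})^[α i] S) T

/-- The regular distribution `φ ↦ ∫ φ(x) u(x) dx` of a locally integrable function `u`
(and `0` if `u` is not locally integrable). -/
def regularDistribution (u : Rn n → V) : 𝓓'((⊤ : TopologicalSpace.Opens (Rn n)), V) :=
  (TestFunction.integralAgainstBilinCLM (ContinuousLinearMap.lsmul ℝ ℝ) volume u :
    𝓓((⊤ : TopologicalSpace.Opens (Rn n)), ℝ) →L[ℝ] V)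

theorem regularDistribution_apply {u : Rn n → V} (hu : LocallyIntegrable u)
    (φ : 𝓓((⊤ : TopologicalSpace.Opens (Rn n)), ℝ)) :
    regularDistribution u φ = ∫ x, φ x • u x :=
  TestFunction.integralAgainstBilinCLM_eq_integral (hu.locallyIntegrableOn _)

/-- The vector-valued Dirac mass `δ₀ w : φ ↦ φ(0) w`. -/
def diracVec (w : W) : 𝓓'((⊤ : TopologicalSpace.Opens (Rn n)), W) :=
  Distribution.mapCLM (ContinuousLinearMap.toSpanSingleton ℝ w) (Distribution.delta 0)

theorem diracVec_apply (w : W) (φ : 𝓓((⊤ : TopologicalSpace.Opens (Rn n)), ℝ)) :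
    diracVec w φ = φ 0 • w := rfl

/-- The operator `𝔹(D) = ∑_{|α| = k} 𝔹_α ∂^α` acting on `V`-valued distributions on `ℝⁿ`. -/
def diffOp (k : ℕ) (B : (Fin n → ℕ) → V →L[ℝ] W)
    (T : 𝓓'((⊤ : TopologicalSpace.Opens (Rn n)), V)) :
    𝓓'((⊤ : TopologicalSpace.Opens (Rn n)), W) :=
  ∑ α ∈ multiIndices n k, Distribution.mapCLM (B α) (partialDeriv α T)

end Distributions

section Symbol

variable {n : ℕ} {V W : Type*} [NormedAddCommGroup V] [NormedSpace ℝ V]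
  [NormedAddCommGroup W] [NormedSpace ℝ W]

/-- The symbol map `𝔹(ξ) = ∑_{|α| = k} ξ^α 𝔹_α`. -/
def symbol (k : ℕ) (B : (Fin n → ℕ) → V →L[ℝ] W) (ξ : Rn n) : V →L[ℝ] W :=
  ∑ α ∈ multiIndices n k, (∏ i, ξ i ^ α i) • B α

/-- The image of `𝔹(ξ)`. -/
def symbolRange (k : ℕ) (B : (Fin n → ℕ) → V →L[ℝ] W) (ξ : Rn n) : Submodule ℝ W :=
  LinearMap.range (symbol k B ξ : V →ₗ[ℝ] W)

/-- The rank of `𝔹(ξ)` is the same for all `ξ ≠ 0`. -/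
def IsConstantRank (k : ℕ) (B : (Fin n → ℕ) → V →L[ℝ] W) : Prop :=
  ∃ r : ℕ, ∀ ξ : Rn n, ξ ≠ 0 → Module.finrank ℝ (symbolRange k B ξ) = r

/-- `⋂_{ξ ∈ 𝕊ⁿ⁻¹} im 𝔹(ξ)`. -/
def commonRange (k : ℕ) (B : (Fin n → ℕ) → V →L[ℝ] W) : Submodule ℝ W :=
  ⨅ ξ ∈ Metric.sphere (0 : Rn n) 1, symbolRange k B ξ

/-- `𝔹(D)` is canceling: `⋂_{ξ ∈ 𝕊ⁿ⁻¹} im 𝔹(ξ) = {0}`. -/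
def IsCanceling (k : ℕ) (B : (Fin n → ℕ) → V →L[ℝ] W) : Prop :=
  commonRange k B = ⊥

/-- A map on `ℝⁿ ∖ {0}` is (positively) homogeneous of degree `d`. -/
def IsHomogeneousAwayFromZero {F : Type*} [AddCommGroup F] [Module ℝ F]
    (d : ℤ) (f : Rn n → F) : Prop :=
  ∀ x : Rn n, x ≠ 0 → ∀ t : ℝ, 0 < t → f (t • x) = t ^ d • f x

end Symbol

end ConstRank

end

/-! Constant rank supplies polynomial matrices A, D and a polynomial c without zeros off the origin,
such that A𝔹 = 0 and A + 𝔹D = c·1 (`exists_annihilator_parametrix`). They come from the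
characteristic polynomial of 𝔹𝔹ᵀ with its factor X^(m-r) removed, where m = dim W. Both directions
rest on them.

If 𝔹(D)u = δ₀w, the annihilator gives A(∂)(δ₀w) = 0, up to the signs of the adjoint. Testing with a
function equal to exp(ξ·x) near 0 yields A(ξ)w = 0, so 𝔹(ξ)D(ξ)w = c(ξ)w and w ∈ im 𝔹(ξ) for every ξ
≠ 0 (`mem_commonRange_of_diffOp_eq_diracVec`). Canceling then forces w = 0.

Conversely, let w lie in every im 𝔹(ξ). Then v = c⁻¹Dw is smooth off 0 and 𝔹(ξ)v(ξ) = w. Formally u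
is the inverse Fourier transform of (2πi)⁻ᵏv, and it is assembled from dyadic-like pieces with a
continuous scale s. Take a cutoff χ equal to 1 near 0, X = Re 𝓕⁻¹χ and φ = -ξ·∇χ, which vanishes
near 0. The real part K of 𝓕⁻¹((2πi)⁻ᵏvφ) is Schwartz and satisfies 𝔹(D)K = div(xX) w
(`exists_schwartz_kernel`). Since s^(n-1) div(xX)(sx) is the s-derivative of sⁿX(sx), which tends to
δ₀ as s → ∞ because ∫X = 1, the superposition u = ∫₀^∞ s^(n-k-1) K(sx) ds solves 𝔹(D)u = δ₀w.

For n ≤ k the integral diverges at s = 0. There a Taylor polynomial P of K of degree < N = k+1-n is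
subtracted for s ≤ 1. As N ≤ k, the operator does not see P (`diffOp_dilatePotential`). Derivatives
of order l ≥ N do not see it either, so they are full integrals over (0, ∞), and rescaling s gives
their homogeneity. -/

noncomputable section

namespace ConstRank

/-! ### Polynomial annihilator and parametrix of a constant rank matrix -/

section PolynomialMatrices
open Polynomial

theorem coeff_iterate_divX {R : Type*} [Semiring R] (p : R[X]) (j i : ℕ) :
    (divX^[j] p).coeff i = p.coeff (i + j) := by
  induction j generalizing i with
  | zero => simp
  | succ j ih => rw [Function.iterate_succ_apply', coeff_divX, ih]; congr 1; ring

/-- The characteristic polynomial of `b * bᵀ`, with the zero roots removed, annihilates `b` and does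
not vanish at `0`. -/
theorem charpoly_self_mul_transpose_divX {m d : ℕ} (b : Matrix (Fin m) (Fin d) ℝ) :
    aeval (b * b.transpose) (divX^[m - b.rank] (b * b.transpose).charpoly) * b = 0 ∧
      (divX^[m - b.rank] (b * b.transpose).charpoly).coeff 0 ≠ 0 := by
  set M := b * b.transpose with hM
  have hMH : M.IsHermitian := by
    rw [hM, ← Matrix.conjTranspose_eq_transpose_of_trivial]
    exact Matrix.isHermitian_mul_conjTranspose_self b
  set e := hMH.eigenvalues
  set q : ℝ[X] := ∏ i ∈ Finset.univ.filter (fun i => e i ≠ 0), (X - C (e i)) with hq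
  have hrank : M.rank = b.rank := Matrix.rank_self_mul_transpose b
  have hcard : (Finset.univ.filter (fun i => ¬ e i ≠ 0)).card = m - b.rank := by
    have h1 := hMH.rank_eq_card_non_zero_eigs
    rw [hrank, Fintype.card_subtype] at h1
    have h2 := Finset.card_filter_add_card_filter_not (s := (Finset.univ : Finset (Fin m)))
      (fun i => e i ≠ 0)
    rw [Finset.card_univ, Fintype.card_fin] at h2
    change b.rank = (Finset.univ.filter (fun i => e i ≠ 0)).card at h1
    omega
  have hchar : M.charpoly = q * X ^ (m - b.rank) := by
    rw [hMH.charpoly_eq, ← Finset.prod_filter_mul_prod_filter_not Finset.univ (fun i => e i ≠ 0),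
      hq, ← hcard]
    congr 1
    apply Finset.prod_eq_pow_card
    intro i hi
    have : hMH.eigenvalues i = 0 := by simpa [e] using hi
    simp [this]
  have hdiv : divX^[m - b.rank] M.charpoly = q := by
    ext i
    rw [coeff_iterate_divX, hchar, coeff_mul_X_pow]
  rw [hdiv]
  constructor
  · set Z := aeval M q with hZ
    have hZM : M * Z = Z * M := by
      rw [hZ]
      conv_lhs => lhs; rw [← aeval_X (R := ℝ) M]
      conv_rhs => rhs; rw [← aeval_X (R := ℝ) M]
      rw [← map_mul, ← map_mul, mul_comm]
    have hCH : Z * M ^ (m - b.rank) = 0 := by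
      have := Matrix.aeval_self_charpoly M
      rwa [hchar, map_mul, map_pow, aeval_X] at this
    have hMM : M.conjTranspose = M := hMH
    -- A symmetric M has no nilpotent part: Y M Mᵀ = 0 forces Y M = 0, so the power of M drops one
    -- at a time.
    have hred : ∀ j : ℕ, Z * M ^ j = 0 → Z * M = 0 := by
      intro j
      induction j with
      | zero => intro h; simp at h; simp [h]
      | succ j ih =>
        intro h
        rcases j with _ | j
        · simpa using h
        · apply ih
          have h' : (Z * M ^ j) * (M * M.conjTranspose) = 0 := by
            rw [hMM, ← h, pow_succ, pow_succ]; simp only [Matrix.mul_assoc]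
          rw [Matrix.mul_self_mul_conjTranspose_eq_zero] at h'
          rw [pow_succ, ← Matrix.mul_assoc, h']
    have h0 := hred _ hCH
    rw [hM, ← Matrix.conjTranspose_eq_transpose_of_trivial,
      Matrix.mul_self_mul_conjTranspose_eq_zero] at h0
    exact h0
  · rw [coeff_zero_eq_eval_zero, hq, eval_prod]
    refine Finset.prod_ne_zero_iff.2 fun i hi => ?_
    simpa using hi

/-- Multiplying by a coordinate, available as n ≥ 1, makes the polynomial vanish at the origin too.
Rank information exists only off the origin, hence the need. -/
theorem _root_.MvPolynomial.eq_zero_of_eval_ne_zero {n : ℕ} (hn : 1 ≤ n)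
    (p : MvPolynomial (Fin n) ℝ)
    (h : ∀ ξ : Fin n → ℝ, ξ ≠ 0 → MvPolynomial.eval ξ p = 0) : p = 0 := by
  have h1 : MvPolynomial.X ⟨0, hn⟩ * p = 0 := by
    apply MvPolynomial.funext
    intro ξ
    by_cases hξ : ξ = 0
    · simp [hξ]
    · simp [h ξ hξ]
  exact (mul_eq_zero.1 h1).resolve_left (MvPolynomial.X_ne_zero _)

/-- A matrix of polynomials of constant rank off the origin has a polynomial annihilator and a
polynomial right parametrix. -/
theorem exists_annihilator_parametrix {n m d : ℕ} (hn : 1 ≤ n)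
    (b : Matrix (Fin m) (Fin d) (MvPolynomial (Fin n) ℝ)) (r : ℕ)
    (hr : ∀ ξ : Fin n → ℝ, ξ ≠ 0 → (b.map (MvPolynomial.eval ξ)).rank = r) :
    ∃ (A : Matrix (Fin m) (Fin m) (MvPolynomial (Fin n) ℝ))
      (D : Matrix (Fin d) (Fin m) (MvPolynomial (Fin n) ℝ)) (c : MvPolynomial (Fin n) ℝ),
      A * b = 0 ∧ A + b * D = c • (1 : Matrix (Fin m) (Fin m) (MvPolynomial (Fin n) ℝ)) ∧
      ∀ ξ : Fin n → ℝ, ξ ≠ 0 → MvPolynomial.eval ξ c ≠ 0 := by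
  set M := b * b.transpose with hM
  set q := divX^[m - r] M.charpoly with hq
  have hMξ : ∀ ξ : Fin n → ℝ, M.map (MvPolynomial.eval ξ) =
      b.map (MvPolynomial.eval ξ) * (b.map (MvPolynomial.eval ξ)).transpose := by
    intro ξ
    rw [hM, Matrix.map_mul, Matrix.transpose_map]
  have hqξ : ∀ ξ : Fin n → ℝ, ξ ≠ 0 → q.map (MvPolynomial.eval ξ) =
      divX^[m - (b.map (MvPolynomial.eval ξ)).rank]
        (b.map (MvPolynomial.eval ξ) * (b.map (MvPolynomial.eval ξ)).transpose).charpoly := by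
    intro ξ hξ
    rw [hr ξ hξ, ← hMξ, Matrix.charpoly_map]
    ext i
    rw [coeff_map, hq, coeff_iterate_divX, coeff_iterate_divX, coeff_map]
  -- From q = X·`divX q` + q(0) follows q(M) - b bᵀ (`divX q`)(M) = q(0). The value q(0) is, up to
  -- sign, the product of the nonzero eigenvalues of M.
  refine ⟨aeval M q, -(b.transpose * aeval M q.divX), q.coeff 0, ?_, ?_, ?_⟩
  · refine Matrix.ext fun i j => ?_
    refine MvPolynomial.eq_zero_of_eval_ne_zero hn _ fun ξ hξ => ?_
    have h := (charpoly_self_mul_transpose_divX (b.map (MvPolynomial.eval ξ))).1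
    rw [← hqξ ξ hξ, ← hMξ] at h
    have h2 : (aeval M q * b).map (MvPolynomial.eval ξ) = 0 := by
      rw [Matrix.map_mul, ← h]
      congr 1
      rw [← RingHom.mapMatrix_apply, ← RingHom.mapMatrix_apply, aeval_def, hom_eval₂, aeval_def,
        eval₂_map]
      congr 1
      refine RingHom.ext fun p => ?_
      ext i j
      by_cases hij : i = j <;> simp [Matrix.algebraMap_matrix_apply, hij]
    exact congrFun (congrFun h2 i) j
  · rw [Matrix.mul_neg, ← Matrix.mul_assoc, ← hM]
    conv_lhs => lhs; rw [← X_mul_divX_add q]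
    rw [map_add, map_mul, aeval_X, aeval_C, Algebra.algebraMap_eq_smul_one]
    abel
  · intro ξ hξ
    have h := (charpoly_self_mul_transpose_divX (b.map (MvPolynomial.eval ξ))).2
    rwa [← hqξ ξ hξ, coeff_map] at h

end PolynomialMatrices

/-! ### Constant coefficient operators acting on test functions -/

section PolynomialAction

/-- Evaluation of a polynomial at a family of commuting elements of a noncommutative algebra. -/
theorem _root_.MvPolynomial.exists_algHom_of_commute {n : ℕ} {A : Type*} [Ring A] [Algebra ℝ A]
    (D : Fin n → A) (hD : ∀ i j, Commute (D i) (D j)) :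
    ∃ ρ : MvPolynomial (Fin n) ℝ →ₐ[ℝ] A, ∀ i, ρ (MvPolynomial.X i) = D i := by
  let Φ : (Fin n → Multiplicative ℕ) →* A :=
    MonoidHom.noncommPiCoprod (fun i => powersHom A (D i))
      (fun i j _ x y => by
        simp only [powersHom_apply]
        exact ((hD i j).pow_left _).pow_right _)
  let Ψ : Multiplicative (Fin n →₀ ℕ) →* (Fin n → Multiplicative ℕ) :=
    { toFun := fun β i => Multiplicative.ofAdd (Multiplicative.toAdd β i)
      map_one' := rfl
      map_mul' := fun _ _ => rfl }
  refine ⟨AddMonoidAlgebra.lift ℝ A (Fin n →₀ ℕ) (Φ.comp Ψ), fun i => ?_⟩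
  have h1 : Ψ (Multiplicative.ofAdd (Finsupp.single i 1)) =
      Pi.mulSingle i (Multiplicative.ofAdd 1) := by
    ext j
    have hj : Multiplicative.toAdd (Ψ (Multiplicative.ofAdd (Finsupp.single i 1)) j) =
      (Finsupp.single i 1 : Fin n →₀ ℕ) j := rfl
    rw [hj]
    rcases eq_or_ne i j with rfl | h
    · simp
    · rw [Finsupp.single_eq_of_ne h.symm, Pi.mulSingle_eq_of_ne h.symm, toAdd_one]
  have h2 : AddMonoidAlgebra.lift ℝ A (Fin n →₀ ℕ) (Φ.comp Ψ)
      (AddMonoidAlgebra.single (Finsupp.single i 1) (1 : ℝ)) = D i := by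
    rw [AddMonoidAlgebra.lift_single, MonoidHom.comp_apply, h1, one_smul]
    refine (MonoidHom.noncommPiCoprod_mulSingle _ i _).trans ?_
    simp
  exact h2

variable {n : ℕ}

/-- The `i`-th standard basis vector of `ℝⁿ`. -/
abbrev stdVec (i : Fin n) : Rn n := EuclideanSpace.single i 1

theorem lineDeriv_testFunction_apply (f : 𝓓((⊤ : TopologicalSpace.Opens (Rn n)), ℝ)) (v x : Rn n) :
    (∂_{v} f) x = fderiv ℝ f x v := by
  rw [TestFunction.lineDerivOp_eq_lineDerivCLM ℝ, TestFunction.lineDerivCLM_eq_fderivCLM,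
    TestFunction.fderivCLM_apply_of_le _ (by simp)]

/-- Partial differentiation of test functions as a linear map. -/
def partialEnd (i : Fin n) : Module.End ℝ 𝓓((⊤ : TopologicalSpace.Opens (Rn n)), ℝ) :=
  (LineDeriv.lineDerivOpCLM ℝ 𝓓((⊤ : TopologicalSpace.Opens (Rn n)), ℝ) (stdVec i) :
    𝓓((⊤ : TopologicalSpace.Opens (Rn n)), ℝ) →ₗ[ℝ] 𝓓((⊤ : TopologicalSpace.Opens (Rn n)), ℝ))

theorem partialEnd_apply (i : Fin n) (f : 𝓓((⊤ : TopologicalSpace.Opens (Rn n)), ℝ)) :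
    partialEnd i f = ∂_{stdVec i} f := rfl

theorem partialEnd_commute (i j : Fin n) : Commute (partialEnd i) (partialEnd j) := by
  refine LinearMap.ext fun f => TestFunction.ext fun x => ?_
  have hf : ContDiff ℝ ∞ f := f.contDiff
  have key : ∀ a b : Fin n, (partialEnd a * partialEnd b) f x =
      fderiv ℝ (fderiv ℝ f) x (stdVec a) (stdVec b) := by
    intro a b
    rw [Module.End.mul_apply, partialEnd_apply, partialEnd_apply, lineDeriv_testFunction_apply]
    have : ((∂_{stdVec b} f : 𝓓((⊤ : TopologicalSpace.Opens (Rn n)), ℝ)) : Rn n → ℝ) =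
        fun y => fderiv ℝ f y (stdVec b) := by
      ext y; exact lineDeriv_testFunction_apply f _ y
    rw [this]
    have hd : DifferentiableAt ℝ (fderiv ℝ f) x :=
      ((hf.fderiv_right (m := 1) (by norm_cast)).differentiable one_ne_zero).differentiableAt
    rw [fderiv_clm_apply hd (differentiableAt_const _)]
    simp
  rw [key, key]
  exact (hf.contDiffAt (x := x)).isSymmSndFDerivAt (by
    rw [minSmoothness_of_isRCLikeNormedField]
    exact WithTop.coe_le_coe.2 (le_top : (2 : ℕ∞) ≤ ⊤)) _ _

/-- A polynomial `p` acting on test functions as the differential operator `p(∂)`. -/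
def polyAction : MvPolynomial (Fin n) ℝ →ₐ[ℝ]
    Module.End ℝ 𝓓((⊤ : TopologicalSpace.Opens (Rn n)), ℝ) :=
  (MvPolynomial.exists_algHom_of_commute partialEnd partialEnd_commute).choose

theorem polyAction_X (i : Fin n) : polyAction (MvPolynomial.X i) = partialEnd i :=
  (MvPolynomial.exists_algHom_of_commute partialEnd partialEnd_commute).choose_spec i

theorem polyAction_mul_apply (p q : MvPolynomial (Fin n) ℝ)
    (f : 𝓓((⊤ : TopologicalSpace.Opens (Rn n)), ℝ)) :
    polyAction (p * q) f = polyAction p (polyAction q f) := by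
  rw [map_mul, Module.End.mul_apply]

/-- Real exponentials are eigenfunctions of p(∂) with eigenvalue p(ξ). Only the germ at 0 matters
against δ₀, so a compactly supported truncation is enough and no Fourier transform is required. -/
theorem polyAction_eventuallyEq_exp (ξ : Rn n) (f : 𝓓((⊤ : TopologicalSpace.Opens (Rn n)), ℝ))
    (hf : f =ᶠ[nhds 0] fun x => Real.exp (inner ℝ ξ x)) (p : MvPolynomial (Fin n) ℝ) :
    polyAction p f =ᶠ[nhds 0] fun x => MvPolynomial.eval ξ p * Real.exp (inner ℝ ξ x) := by
  induction p using MvPolynomial.induction_on with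
  | C a =>
    have : polyAction (MvPolynomial.C a) f = a • f := by
      rw [← MvPolynomial.algebraMap_eq, AlgHom.commutes, Module.algebraMap_end_apply]
    rw [this]
    filter_upwards [hf] with x hx
    simp [hx]
  | add p q hp hq =>
    filter_upwards [hp, hq] with x h1 h2
    have : polyAction (p + q) f = polyAction p f + polyAction q f := by
      rw [map_add, LinearMap.add_apply]
    rw [this, add_apply, h1, h2, map_add, add_mul]
  | mul_X p i hp =>
    have h := hp.fderiv (𝕜 := ℝ)
    filter_upwards [h] with x hx
    rw [mul_comm, polyAction_mul_apply, polyAction_X, partialEnd_apply,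
      lineDeriv_testFunction_apply, hx]
    have hd : HasFDerivAt (fun x : Rn n => MvPolynomial.eval ξ p * Real.exp (inner ℝ ξ x))
        (MvPolynomial.eval ξ p • (Real.exp (inner ℝ ξ x) • (innerSL ℝ ξ : Rn n →L[ℝ] ℝ))) x :=
      (((innerSL ℝ ξ : Rn n →L[ℝ] ℝ).hasFDerivAt (x := x)).exp).const_mul _
    rw [hd.fderiv]
    simp [EuclideanSpace.inner_single_right]
    ring

theorem exists_testFunction_eventuallyEq_exp (ξ : Rn n) :
    ∃ f : 𝓓((⊤ : TopologicalSpace.Opens (Rn n)), ℝ),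
      f =ᶠ[nhds 0] fun x => Real.exp (inner ℝ ξ x) := by
  let χ : ContDiffBump (0 : Rn n) := ⟨1, 2, one_pos, one_lt_two⟩
  refine ⟨⟨fun x => χ x * Real.exp (inner ℝ ξ x), ?_, ?_, ?_⟩, ?_⟩
  · exact χ.contDiff.mul (Real.contDiff_exp.comp (contDiff_const.inner ℝ contDiff_id))
  · exact χ.hasCompactSupport.mul_right
  · exact Set.subset_univ _
  · filter_upwards [χ.eventuallyEq_one] with x hx
    rw [TestFunction.coe_mk, hx, Pi.one_apply, one_mul]

end PolynomialAction

/-! ### The operator 𝔹(D) transposed onto test functions -/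

section Adjoint
variable {n : ℕ} {V W : Type*} [NormedAddCommGroup V] [NormedSpace ℝ V]
  [NormedAddCommGroup W] [NormedSpace ℝ W]

/-- The monomial `X^α`. -/
def monom (α : Fin n → ℕ) : MvPolynomial (Fin n) ℝ := ∏ i, MvPolynomial.X i ^ α i

theorem iterate_lineDeriv_apply (T : 𝓓'((⊤ : TopologicalSpace.Opens (Rn n)), V)) (i : Fin n) (j : ℕ)
    (f : 𝓓((⊤ : TopologicalSpace.Opens (Rn n)), ℝ)) :
    ((∂_{stdVec i})^[j] T : 𝓓'((⊤ : TopologicalSpace.Opens (Rn n)), V)) f =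
      (-1 : ℝ) ^ j • T (polyAction (MvPolynomial.X i ^ j) f) := by
  induction j generalizing f with
  | zero => simp
  | succ j ih =>
    rw [Function.iterate_succ_apply', Distribution.lineDerivOp_apply_apply, map_neg, ih, pow_succ,
      pow_succ, polyAction_mul_apply, polyAction_X, partialEnd_apply]
    simp

theorem partialDeriv_apply (α : Fin n → ℕ) (T : 𝓓'((⊤ : TopologicalSpace.Opens (Rn n)), V))
    (f : 𝓓((⊤ : TopologicalSpace.Opens (Rn n)), ℝ)) :
    partialDeriv α T f = (-1 : ℝ) ^ (∑ i, α i) • T (polyAction (monom α) f) := by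
  have key : ∀ (l : List (Fin n)) (f : 𝓓((⊤ : TopologicalSpace.Opens (Rn n)), ℝ)),
      (l.foldr (fun i S => (∂_{stdVec i})^[α i] S) T) f = (-1 : ℝ) ^ ((l.map α).sum) •
        T (polyAction ((l.map fun i => MvPolynomial.X i ^ α i).prod) f) := by
    intro l
    induction l with
    | nil => intro f; simp
    | cons i l ih =>
      intro f
      rw [List.foldr_cons, iterate_lineDeriv_apply, ih, List.map_cons, List.sum_cons,
        List.map_cons, List.prod_cons, mul_comm, polyAction_mul_apply, pow_add, smul_smul]
  rw [partialDeriv, key, monom, Fin.prod_univ_def, Fin.sum_univ_def]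

/-- All multi-indices have length k, so the signs from moving the derivatives combine into one
factor (-1)ᵏ. -/
theorem diffOp_apply (k : ℕ) (B : (Fin n → ℕ) → V →L[ℝ] W)
    (T : 𝓓'((⊤ : TopologicalSpace.Opens (Rn n)), V))
    (f : 𝓓((⊤ : TopologicalSpace.Opens (Rn n)), ℝ)) :
    diffOp k B T f =
      (-1 : ℝ) ^ k • ∑ α ∈ multiIndices n k, B α (T (polyAction (monom α) f)) := by
  have h : diffOp k B T f =
      ∑ α ∈ multiIndices n k, Distribution.mapCLM (B α) (partialDeriv α T) f := by
    rw [diffOp]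
    simp
  rw [h, Finset.smul_sum]
  refine Finset.sum_congr rfl fun α hα => ?_
  have hα' : ∑ i, α i = k := by simpa using (Finset.mem_piAntidiag.1 hα).1
  rw [Distribution.mapCLM_apply, partialDeriv_apply, hα', map_smul]

end Adjoint

/-! ### The symbol as a polynomial matrix, and necessity of w ∈ im 𝔹(ξ) -/

section SymbolMatrix
variable {n d m : ℕ} {V W : Type*} [NormedAddCommGroup V] [NormedSpace ℝ V]
  [NormedAddCommGroup W] [NormedSpace ℝ W]

theorem eval_monom (α : Fin n → ℕ) (ξ : Fin n → ℝ) :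
    MvPolynomial.eval ξ (monom α) = ∏ i, ξ i ^ α i := by
  simp [monom]

/-- The matrix of the symbol, with polynomial entries. -/
def symbolMatrix (bV : Module.Basis (Fin d) ℝ V) (bW : Module.Basis (Fin m) ℝ W) (k : ℕ)
    (B : (Fin n → ℕ) → V →L[ℝ] W) : Matrix (Fin m) (Fin d) (MvPolynomial (Fin n) ℝ) :=
  fun i j => ∑ α ∈ multiIndices n k, bW.repr (B α (bV j)) i • monom α

theorem symbolMatrix_map_eval (bV : Module.Basis (Fin d) ℝ V) (bW : Module.Basis (Fin m) ℝ W)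
    (k : ℕ) (B : (Fin n → ℕ) → V →L[ℝ] W) (ξ : Rn n) :
    (symbolMatrix bV bW k B).map (MvPolynomial.eval ξ) =
      LinearMap.toMatrix bV bW (symbol k B ξ : V →ₗ[ℝ] W) := by
  ext i j
  rw [Matrix.map_apply, LinearMap.toMatrix_apply, symbolMatrix, map_sum]
  simp only [MvPolynomial.smul_eval, eval_monom]
  simp [symbol, mul_comm]

theorem rank_symbolMatrix_map_eval (bV : Module.Basis (Fin d) ℝ V)
    (bW : Module.Basis (Fin m) ℝ W) (k : ℕ) (B : (Fin n → ℕ) → V →L[ℝ] W) (ξ : Rn n) :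
    ((symbolMatrix bV bW k B).map (MvPolynomial.eval ξ)).rank =
      Module.finrank ℝ (symbolRange k B ξ) := by
  rw [symbolMatrix_map_eval, Matrix.rank_eq_finrank_range_toLin _ bW bV, Matrix.toLin_toMatrix]
  rfl

theorem symbol_equivFun_symm (bV : Module.Basis (Fin d) ℝ V) (bW : Module.Basis (Fin m) ℝ W)
    (k : ℕ) (B : (Fin n → ℕ) → V →L[ℝ] W) (ξ : Rn n) (y : Fin d → ℝ) :
    bW.equivFun (symbol k B ξ (bV.equivFun.symm y)) =
      ((symbolMatrix bV bW k B).map (MvPolynomial.eval ξ)).mulVec y := by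
  rw [symbolMatrix_map_eval]
  have h := LinearMap.toMatrix_mulVec_repr bV bW (symbol k B ξ : V →ₗ[ℝ] W) (bV.equivFun.symm y)
  have h2 : (bV.repr (bV.equivFun.symm y) : Fin d → ℝ) = y := bV.equivFun.apply_symm_apply y
  rw [h2] at h
  exact h.symm

theorem diffOp_coord (bV : Module.Basis (Fin d) ℝ V) (bW : Module.Basis (Fin m) ℝ W)
    (k : ℕ) (B : (Fin n → ℕ) → V →L[ℝ] W)
    (T : 𝓓'((⊤ : TopologicalSpace.Opens (Rn n)), V))
    (f : 𝓓((⊤ : TopologicalSpace.Opens (Rn n)), ℝ)) (i : Fin m) :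
    bW.repr (diffOp k B T f) i = (-1 : ℝ) ^ k *
      ∑ j, bV.repr (T (polyAction (symbolMatrix bV bW k B i j) f)) j := by
  rw [diffOp_apply, map_smul, map_sum]
  simp only [Finsupp.smul_apply, Finsupp.finsetSum_apply, smul_eq_mul]
  congr 1
  have h1 : ∀ α, bW.repr (B α (T (polyAction (monom α) f))) i =
      ∑ j, bV.repr (T (polyAction (monom α) f)) j * bW.repr (B α (bV j)) i := by
    intro α
    conv_lhs => rw [← bV.sum_repr (T (polyAction (monom α) f))]
    simp only [map_sum, map_smul, Finsupp.finsetSum_apply, Finsupp.smul_apply, smul_eq_mul]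
  simp only [h1, symbolMatrix]
  rw [Finset.sum_comm]
  refine Finset.sum_congr rfl fun j _ => ?_
  have h2 : polyAction (∑ α ∈ multiIndices n k, bW.repr (B α (bV j)) i • monom α) f =
      ∑ α ∈ multiIndices n k, bW.repr (B α (bV j)) i • polyAction (monom α) f := by
    rw [map_sum, LinearMap.sum_apply]
    simp only [map_smul, LinearMap.smul_apply]
  rw [h2, map_sum, map_sum]
  simp [mul_comm]

variable {k : ℕ} {B : (Fin n → ℕ) → V →L[ℝ] W}

/-- By k-homogeneity of the symbol, im 𝔹(ξ) depends only on the direction of ξ. -/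
theorem mem_commonRange_iff {w : W} :
    w ∈ commonRange k B ↔ ∀ ξ : Rn n, ξ ≠ 0 → w ∈ symbolRange k B ξ := by
  have hsymb : ∀ (ξ : Rn n) (t : ℝ), symbol k B (t • ξ) = t ^ k • symbol k B ξ := by
    intro ξ t
    simp only [symbol, Finset.smul_sum, smul_smul]
    refine Finset.sum_congr rfl fun α hα => ?_
    congr 1
    have hα' : ∑ i, α i = k := by simpa using (Finset.mem_piAntidiag.1 hα).1
    simp [mul_pow, Finset.prod_mul_distrib, Finset.prod_pow_eq_pow_sum, hα']
  simp only [commonRange, Submodule.mem_iInf]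
  constructor
  · intro h ξ hξ
    obtain ⟨v, hv⟩ := h (‖ξ‖⁻¹ • ξ) (by
      simp [norm_smul, inv_mul_cancel₀ (norm_ne_zero_iff.2 hξ)])
    refine ⟨(‖ξ‖⁻¹) ^ k • v, ?_⟩
    rw [← hv, map_smul]
    simp [hsymb]
  · intro h ξ hξ
    refine h ξ ?_
    rintro rfl
    simp at hξ

theorem IsConstantRank.exists_annihilator_parametrix (hB : IsConstantRank k B) (hn : 1 ≤ n)
    (bV : Module.Basis (Fin d) ℝ V) (bW : Module.Basis (Fin m) ℝ W) :
    ∃ (A : Matrix (Fin m) (Fin m) (MvPolynomial (Fin n) ℝ))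
      (D : Matrix (Fin d) (Fin m) (MvPolynomial (Fin n) ℝ)) (c : MvPolynomial (Fin n) ℝ),
      A * symbolMatrix bV bW k B = 0 ∧
      A + symbolMatrix bV bW k B * D =
        c • (1 : Matrix (Fin m) (Fin m) (MvPolynomial (Fin n) ℝ)) ∧
      ∀ ξ : Fin n → ℝ, ξ ≠ 0 → MvPolynomial.eval ξ c ≠ 0 := by
  obtain ⟨r, hr⟩ := hB
  refine ConstRank.exists_annihilator_parametrix hn _ r fun ξ hξ => ?_
  have h := rank_symbolMatrix_map_eval bV bW k B (WithLp.toLp 2 ξ)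
  rw [hr _ (by simpa using hξ)] at h
  exact h

theorem symbol_parametrix_apply (bV : Module.Basis (Fin d) ℝ V) (bW : Module.Basis (Fin m) ℝ W)
    {A : Matrix (Fin m) (Fin m) (MvPolynomial (Fin n) ℝ)}
    {D : Matrix (Fin d) (Fin m) (MvPolynomial (Fin n) ℝ)} {c : MvPolynomial (Fin n) ℝ}
    (hD : A + symbolMatrix bV bW k B * D =
        c • (1 : Matrix (Fin m) (Fin m) (MvPolynomial (Fin n) ℝ))) (ξ : Rn n) (w : W)
    (hA : (A.map (MvPolynomial.eval ξ)).mulVec (bW.equivFun w) = 0) :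
    symbol k B ξ (bV.equivFun.symm ((D.map (MvPolynomial.eval ξ)).mulVec (bW.equivFun w))) =
      MvPolynomial.eval ξ c • w := by
  apply bW.equivFun.injective
  rw [symbol_equivFun_symm, map_smul, Matrix.mulVec_mulVec, ← Matrix.map_mul]
  have h := congrArg (fun M : Matrix (Fin m) (Fin m) (MvPolynomial (Fin n) ℝ) =>
    (M.map (MvPolynomial.eval ξ)).mulVec (bW.equivFun w)) hD
  simp only [Matrix.map_add _ (map_add (MvPolynomial.eval ξ)), Matrix.add_mulVec] at h
  rw [hA, zero_add] at h
  rw [h]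
  have h1 : (c • (1 : Matrix (Fin m) (Fin m) (MvPolynomial (Fin n) ℝ))).map (MvPolynomial.eval ξ) =
      MvPolynomial.eval ξ c • (1 : Matrix (Fin m) (Fin m) ℝ) := by
    ext i j
    by_cases hij : i = j <;> simp [hij]
  rw [h1, Matrix.smul_mulVec, Matrix.one_mulVec]

/-- If `δ₀ w` is in the image of a constant rank operator on distributions, then `w` lies in the
image of all `𝔹(ξ)`. -/
theorem mem_commonRange_of_diffOp_eq_diracVec [FiniteDimensional ℝ V] [FiniteDimensional ℝ W]
    (hn : 1 ≤ n) (hB : IsConstantRank k B) {w : W}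
    (T : 𝓓'((⊤ : TopologicalSpace.Opens (Rn n)), V)) (hT : diffOp k B T = diracVec w) :
    w ∈ commonRange k B := by
  rw [mem_commonRange_iff]
  intro ξ hξ
  let bV := Module.finBasis ℝ V
  let bW := Module.finBasis ℝ W
  obtain ⟨A, D, c, hA, hD, hc⟩ := hB.exists_annihilator_parametrix hn bV bW
  obtain ⟨f, hf⟩ := exists_testFunction_eventuallyEq_exp ξ
  -- Row l of A is moved onto the test function: summing over i, the right sides combine into the
  -- action of (A𝔹)ₗⱼ = 0, while the left sides evaluate to (A(ξ)w)ₗ.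
  have hAw : (A.map (MvPolynomial.eval ξ)).mulVec (bW.equivFun w) = 0 := by
    ext l
    have h1 : ∀ i, polyAction (A l i) f 0 * bW.repr w i = (-1 : ℝ) ^ k *
        ∑ j, bV.repr (T (polyAction (A l i * symbolMatrix bV bW k B i j) f)) j := by
      intro i
      have h := diffOp_coord bV bW k B T (polyAction (A l i) f) i
      rw [hT, diracVec_apply, map_smul, Finsupp.smul_apply, smul_eq_mul] at h
      rw [h]
      simp only [← polyAction_mul_apply, mul_comm (A l i)]
    have h2 : ∑ i, ∑ j, bV.repr (T (polyAction (A l i * symbolMatrix bV bW k B i j) f)) j = 0 := by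
      rw [Finset.sum_comm]
      refine Finset.sum_eq_zero fun j _ => ?_
      have h3 : ∑ i, A l i * symbolMatrix bV bW k B i j = 0 := by
        have := congrFun (congrFun hA l) j
        rwa [Matrix.mul_apply] at this
      have h4 : ∑ i, bV.repr (T (polyAction (A l i * symbolMatrix bV bW k B i j) f)) j =
          bV.repr (T (polyAction (∑ i, A l i * symbolMatrix bV bW k B i j) f)) j := by
        rw [map_sum, LinearMap.sum_apply, map_sum, map_sum, Finsupp.finsetSum_apply]
      rw [h4, h3]
      simp
    have h5 : ∑ i, polyAction (A l i) f 0 * bW.repr w i = 0 := by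
      simp only [h1, ← Finset.mul_sum, h2, mul_zero]
    have h6 : ∀ i, polyAction (A l i) f 0 = MvPolynomial.eval ξ (A l i) := by
      intro i
      have := (polyAction_eventuallyEq_exp ξ f hf (A l i)).self_of_nhds
      simpa using this
    simp only [h6] at h5
    exact h5
  refine ⟨(MvPolynomial.eval ξ c)⁻¹ •
    bV.equivFun.symm ((D.map (MvPolynomial.eval ξ)).mulVec (bW.equivFun w)), ?_⟩
  have h := symbol_parametrix_apply bV bW hD ξ w hAw
  have hc' := hc ξ (by simpa using hξ)
  rw [ContinuousLinearMap.coe_coe, map_smul, h, smul_smul, inv_mul_cancel₀ hc', one_smul]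

end SymbolMatrix

/-! ### Taylor polynomials in normed spaces -/

section Taylor
universe u v
variable {E : Type u} [NormedAddCommGroup E] [NormedSpace ℝ E]

/-- The term of degree `j` of the Taylor expansion of `G` at `0`. -/
def taylorTerm : (j : ℕ) → {F : Type (max u v)} → [NormedAddCommGroup F] → [NormedSpace ℝ F] →
    (E → F) → E → F
  | 0, _, _, _, G => fun _ => G 0
  | j + 1, _, _, _, G => fun x => ((j : ℝ) + 1)⁻¹ • taylorTerm j (fderiv ℝ G) x x

theorem taylorTerm_zero {F : Type (max u v)} [NormedAddCommGroup F] [NormedSpace ℝ F]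
    (G : E → F) (x : E) : taylorTerm.{u, v} 0 G x = G 0 := rfl

theorem taylorTerm_succ {F : Type (max u v)} [NormedAddCommGroup F] [NormedSpace ℝ F]
    (j : ℕ) (G : E → F) (x : E) :
    taylorTerm.{u, v} (j + 1) G x = ((j : ℝ) + 1)⁻¹ • taylorTerm.{u, v} j (fderiv ℝ G) x x := rfl

theorem contDiff_taylorTerm (j : ℕ) {F : Type (max u v)} [NormedAddCommGroup F] [NormedSpace ℝ F]
    (G : E → F) : ContDiff ℝ ∞ (taylorTerm.{u, v} j G) := by
  induction j generalizing F with
  | zero => exact contDiff_const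
  | succ j ih => exact contDiff_const.smul ((ih (fderiv ℝ G)).clm_apply contDiff_id)

theorem taylorTerm_clm_comp (j : ℕ) {F F' : Type (max u v)} [NormedAddCommGroup F]
    [NormedSpace ℝ F] [NormedAddCommGroup F'] [NormedSpace ℝ F'] (L : F →L[ℝ] F') {G : E → F}
    (hG : ContDiff ℝ ∞ G) (x : E) :
    taylorTerm.{u, v} j (fun y => L (G y)) x = L (taylorTerm.{u, v} j G x) := by
  induction j generalizing F F' with
  | zero => rfl
  | succ j ih =>
    have h1 : fderiv ℝ (fun y => L (G y)) =
        fun y => (ContinuousLinearMap.compL ℝ E F F' L) (fderiv ℝ G y) := by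
      ext1 y
      exact (L.hasFDerivAt.comp y (hG.differentiable (by simp) y).hasFDerivAt).fderiv
    rw [taylorTerm_succ, taylorTerm_succ, h1, ih _ (hG.fderiv_right (by norm_cast)), map_smul]
    rfl

theorem fderiv_taylorTerm_succ_apply (j : ℕ) {F : Type (max u v)} [NormedAddCommGroup F]
    [NormedSpace ℝ F] (G : E → F) (x h : E) :
    fderiv ℝ (taylorTerm.{u, v} (j + 1) G) x h = ((j : ℝ) + 1)⁻¹ •
      (taylorTerm.{u, v} j (fderiv ℝ G) x h +
        fderiv ℝ (taylorTerm.{u, v} j (fderiv ℝ G)) x h x) := by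
  have hd : DifferentiableAt ℝ (taylorTerm.{u, v} j (fderiv ℝ G)) x :=
    (contDiff_taylorTerm j _).differentiable (by simp) x
  have h1 : HasFDerivAt (taylorTerm.{u, v} (j + 1) G) _ x :=
    (hd.hasFDerivAt.clm_apply (hasFDerivAt_id x)).const_smul ((j : ℝ) + 1)⁻¹
  rw [h1.fderiv]
  simp

/-- Differentiation commutes with Taylor expansion, lowering the degree by one. The product rule
gives two terms, which symmetry of the second derivative makes proportional. -/
theorem fderiv_taylorTerm_succ (j : ℕ) {F : Type (max u v)} [NormedAddCommGroup F]
    [NormedSpace ℝ F] {G : E → F} (hG : ContDiff ℝ ∞ G) :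
    fderiv ℝ (taylorTerm.{u, v} (j + 1) G) = taylorTerm.{u, v} j (fderiv ℝ G) := by
  induction j generalizing F with
  | zero =>
    ext x h
    rw [fderiv_taylorTerm_succ_apply]
    have : taylorTerm.{u, v} 0 (fderiv ℝ G) = fun _ => fderiv ℝ G 0 := rfl
    simp [this]
  | succ j ih =>
    ext x h
    have hG' : ContDiff ℝ ∞ (fderiv ℝ G) := hG.fderiv_right (by norm_cast)
    have hG'' : ContDiff ℝ ∞ (fderiv ℝ (fderiv ℝ G)) := hG'.fderiv_right (by norm_cast)
    -- Symmetry of D²G is passed through the Taylor term as invariance under the linear flip map.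
    have hflip : (fun y => (ContinuousLinearMap.flipₗᵢ ℝ E E F :
        (E →L[ℝ] E →L[ℝ] F) →L[ℝ] (E →L[ℝ] E →L[ℝ] F)) (fderiv ℝ (fderiv ℝ G) y)) =
        fderiv ℝ (fderiv ℝ G) := by
      ext y a b
      exact (hG.contDiffAt (x := y)).isSymmSndFDerivAt (by
        rw [minSmoothness_of_isRCLikeNormedField]
        exact WithTop.coe_le_coe.2 (le_top : (2 : ℕ∞) ≤ ⊤)) _ _
    have hsymm : taylorTerm.{u, v} j (fderiv ℝ (fderiv ℝ G)) x h x =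
        taylorTerm.{u, v} j (fderiv ℝ (fderiv ℝ G)) x x h := by
      conv_lhs => rw [← hflip]
      rw [taylorTerm_clm_comp j _ hG'']
      rfl
    rw [fderiv_taylorTerm_succ_apply, ih hG', hsymm, taylorTerm_succ, smul_apply]
    match_scalars
    field_simp
    ring

theorem exists_taylorPolynomial (N : ℕ) {F : Type (max u v)} [NormedAddCommGroup F]
    [NormedSpace ℝ F] {G : E → F} (hG : ContDiff ℝ ∞ G) :
    ∃ P : E → F, ContDiff ℝ ∞ P ∧ (∀ x, iteratedFDeriv ℝ N P x = 0) ∧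
      ∀ j < N, iteratedFDeriv ℝ j P 0 = iteratedFDeriv ℝ j G 0 := by
  refine ⟨fun x => ∑ j ∈ Finset.range N, taylorTerm.{u, v} j G x,
    ContDiff.sum fun j _ => contDiff_taylorTerm j G, ?_⟩
  induction N generalizing F with
  | zero => simp
  | succ N ih =>
    have hG' : ContDiff ℝ ∞ (fderiv ℝ G) := hG.fderiv_right (by norm_cast)
    have hP : (fderiv ℝ fun x => ∑ j ∈ Finset.range (N + 1), taylorTerm.{u, v} j G x) =
        fun x => ∑ j ∈ Finset.range N, taylorTerm.{u, v} j (fderiv ℝ G) x := by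
      ext1 x
      rw [fderiv_fun_sum fun j _ => (contDiff_taylorTerm j G).differentiable (by simp) x,
        Finset.sum_range_succ']
      have h0 : fderiv ℝ (taylorTerm.{u, v} 0 G) x = 0 := by
        have : taylorTerm.{u, v} 0 G = fun _ => G 0 := rfl
        simp [this]
      simp only [fderiv_taylorTerm_succ _ hG]
      exact (congrArg _ h0).trans (add_zero _)
    obtain ⟨ih1, ih2⟩ := ih hG'
    constructor
    · intro x
      rw [iteratedFDeriv_succ_eq_comp_right, hP, Function.comp_apply, ih1 x]
      exact LinearIsometryEquiv.map_zero _
    · intro j hj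
      rcases j with _ | j
      · ext v
        rw [iteratedFDeriv_zero_apply, iteratedFDeriv_zero_apply, Finset.sum_range_succ',
          taylorTerm_zero, Finset.sum_eq_zero, zero_add]
        intro j _
        rw [taylorTerm_succ, map_zero, smul_zero]
      · rw [iteratedFDeriv_succ_eq_comp_right, hP, Function.comp_apply, ih2 j (by omega),
          iteratedFDeriv_succ_eq_comp_right, Function.comp_apply]

/-- Bound near the origin for the derivatives of a function vanishing to order `N` at `0`. -/
theorem exists_norm_iteratedFDeriv_le_of_vanishing [ProperSpace E] {F : Type*}
    [NormedAddCommGroup F] [NormedSpace ℝ F] {G : E → F} (hG : ContDiff ℝ ∞ G) {N : ℕ}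
    (h0 : ∀ j < N, iteratedFDeriv ℝ j G 0 = 0) (r : ℝ) (l : ℕ) :
    ∃ C, 0 ≤ C ∧ ∀ y, ‖y‖ ≤ r → ‖iteratedFDeriv ℝ l G y‖ ≤ C * ‖y‖ ^ (N - l) := by
  -- Downward induction on l with truncated m = N - l. For l ≥ N compactness gives a constant bound;
  -- below, the mean value inequality gains one power of ‖y‖.
  have key : ∀ m l, N - l = m →
      ∃ C, 0 ≤ C ∧ ∀ y, ‖y‖ ≤ r → ‖iteratedFDeriv ℝ l G y‖ ≤ C * ‖y‖ ^ m := by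
    intro m
    induction m with
    | zero =>
      intro l _
      have hc : Continuous (iteratedFDeriv ℝ l G) :=
        hG.continuous_iteratedFDeriv (by exact_mod_cast le_top)
      obtain ⟨C, hC⟩ := (isCompact_closedBall (0 : E) r).exists_bound_of_continuousOn hc.continuousOn
      refine ⟨max C 0, le_max_right _ _, fun y hy => ?_⟩
      simpa using Or.inl (hC y (by simpa using hy))
    | succ m ih =>
      intro l hl
      obtain ⟨C, hC0, hC⟩ := ih (l + 1) (by omega)
      refine ⟨C, hC0, fun y hy => ?_⟩
      have hbound : ∀ z ∈ Metric.closedBall (0 : E) ‖y‖,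
          ‖fderiv ℝ (iteratedFDeriv ℝ l G) z‖ ≤ C * ‖y‖ ^ m := by
        intro z hz
        rw [mem_closedBall_zero_iff] at hz
        rw [norm_fderiv_iteratedFDeriv]
        exact (hC z (hz.trans hy)).trans (by gcongr)
      have h := (convex_closedBall (0 : E) ‖y‖).norm_image_sub_le_of_norm_fderiv_le
        (fun z _ => (hG.differentiable_iteratedFDeriv (m := l)
          (WithTop.coe_lt_coe.2 (ENat.natCast_lt_top l))) z) hbound
        (x := 0) (y := y) (by simp) (by simp)
      rw [h0 l (by omega), sub_zero, sub_zero, mul_assoc, ← pow_succ] at h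
      exact h
  exact key _ l rfl

end Taylor

/-! ### Differentiating superpositions of dilates -/

section ScaleIntegral
variable {n : ℕ}

/-- The superposition `∫_S s^e G(s x) ds` of dilates of `G`. -/
def scaleIntegral {F : Type*} [NormedAddCommGroup F] [NormedSpace ℝ F] (S : Set ℝ) (e : ℤ)
    (G : Rn n → F) (x : Rn n) : F :=
  ∫ s in S, s ^ e • G (s • x)

/-- The dilates `s^e G(s x)`, `s ∈ S`, are dominated by an integrable function of `s`, locally
uniformly in `x ∈ U`. -/
def DilateDominated {F : Type*} [NormedAddCommGroup F] [NormedSpace ℝ F] (S : Set ℝ) (e : ℤ)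
    (G : Rn n → F) (U : Set (Rn n)) : Prop :=
  ∀ x₀ ∈ U, ∃ δ > 0, ∃ b : ℝ → ℝ, IntegrableOn b S ∧
    ∀ s ∈ S, ∀ x ∈ Metric.ball x₀ δ, ‖s ^ e • G (s • x)‖ ≤ b s

variable {F : Type*} [NormedAddCommGroup F] [NormedSpace ℝ F]

theorem aestronglyMeasurable_dilate {G : Rn n → F} (hG : Continuous G) (S : Set ℝ) (e : ℤ)
    (x : Rn n) : AEStronglyMeasurable (fun s : ℝ => s ^ e • G (s • x)) (volume.restrict S) := by
  refine AEStronglyMeasurable.smul ?_ ?_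
  · exact (Measurable.pow_const measurable_id e).aestronglyMeasurable
  · exact (hG.comp (by fun_prop)).aestronglyMeasurable

theorem DilateDominated.integrableOn {S : Set ℝ} {e : ℤ} {G : Rn n → F} {U : Set (Rn n)}
    (h : DilateDominated S e G U) (hS : MeasurableSet S) (hG : Continuous G) {x : Rn n}
    (hx : x ∈ U) : IntegrableOn (fun s : ℝ => s ^ e • G (s • x)) S := by
  obtain ⟨δ, hδ, b, hb, hbound⟩ := h x hx
  refine Integrable.mono' hb (aestronglyMeasurable_dilate hG S e x) ?_
  filter_upwards [ae_restrict_mem hS] with s hs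
  exact hbound s hs x (Metric.mem_ball_self hδ)

theorem DilateDominated.congr_norm {S : Set ℝ} {e : ℤ} {G : Rn n → F} {U : Set (Rn n)}
    {F' : Type*} [NormedAddCommGroup F'] [NormedSpace ℝ F'] {G' : Rn n → F'}
    (h : DilateDominated S e G U) (hn : ∀ x, ‖G' x‖ = ‖G x‖) : DilateDominated S e G' U := by
  intro x₀ hx₀
  obtain ⟨δ, hδ, b, hb, hbound⟩ := h x₀ hx₀
  refine ⟨δ, hδ, b, hb, fun s hs x hx => ?_⟩
  have := hbound s hs x hx
  rw [norm_smul] at this ⊢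
  rwa [hn]

/-- Differentiation under the integral; the chain rule contributes a factor s, so the exponent e
becomes e + 1. -/
theorem hasFDerivAt_scaleIntegral {S : Set ℝ} (hS : MeasurableSet S) (hS0 : ∀ s ∈ S, s ≠ 0)
    {e : ℤ} {G : Rn n → F} (hG : ContDiff ℝ 1 G) {U : Set (Rn n)}
    (h0 : DilateDominated S e G U) (h1 : DilateDominated S (e + 1) (fderiv ℝ G) U)
    {x : Rn n} (hx : x ∈ U) :
    HasFDerivAt (scaleIntegral S e G) (scaleIntegral S (e + 1) (fderiv ℝ G) x) x := by
  obtain ⟨δ, hδ, b, hb, hbound⟩ := h1 x hx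
  have hG' : Continuous (fderiv ℝ G) := hG.continuous_fderiv one_ne_zero
  refine hasFDerivAt_integral_of_dominated_of_fderiv_le (bound := b)
    (F' := fun x s => s ^ (e + 1) • fderiv ℝ G (s • x)) (Metric.ball_mem_nhds x hδ) ?_
    (h0.integrableOn hS hG.continuous hx) ?_ ?_ hb ?_
  · exact Filter.Eventually.of_forall fun y => aestronglyMeasurable_dilate hG.continuous S e y
  · exact aestronglyMeasurable_dilate hG' S (e + 1) x
  · filter_upwards [ae_restrict_mem hS] with s hs y hy
    exact hbound s hs y hy
  · filter_upwards [ae_restrict_mem hS] with s hs y _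
    have hd : HasFDerivAt G (fderiv ℝ G (s • y)) (s • y) :=
      (hG.differentiable one_ne_zero _).hasFDerivAt
    have h : HasFDerivAt (fun y => s ^ e • G (s • y)) _ y :=
      (hd.comp y ((hasFDerivAt_id y).const_smul s)).const_smul (s ^ e)
    refine h.congr_fderiv (ContinuousLinearMap.ext fun v => ?_)
    rw [smul_apply, smul_apply, ContinuousLinearMap.comp_apply, smul_apply, map_smul, smul_smul,
      zpow_add_one₀ (hS0 s hs), ContinuousLinearMap.id_apply]

theorem scaleIntegral_equiv_comp {F' : Type*} [NormedAddCommGroup F'] [NormedSpace ℝ F']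
    (L : F ≃L[ℝ] F') (S : Set ℝ) (e : ℤ) (G : Rn n → F) (x : Rn n) :
    scaleIntegral S e (fun y => L (G y)) x = L (scaleIntegral S e G x) := by
  rw [scaleIntegral, scaleIntegral, ← L.integral_comp_comm]
  simp

theorem scaleIntegral_iteratedFDeriv {F : Type*} [NormedAddCommGroup F] [NormedSpace ℝ F]
    {S : Set ℝ} (hS : MeasurableSet S) (hS0 : ∀ s ∈ S, s ≠ 0) {U : Set (Rn n)} (hU : IsOpen U)
    (l : ℕ) {e : ℤ} {G : Rn n → F} (hG : ContDiff ℝ ∞ G)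
    (h : ∀ l : ℕ, DilateDominated S (e + l) (iteratedFDeriv ℝ l G) U) :
    ContDiffOn ℝ l (scaleIntegral S e G) U ∧ ∀ x ∈ U,
      iteratedFDeriv ℝ l (scaleIntegral S e G) x =
        scaleIntegral S (e + l) (iteratedFDeriv ℝ l G) x := by
  -- The target space is quantified because the induction replaces G by its derivative.
  have h1 : ∀ {F : Type _} [NormedAddCommGroup F] [NormedSpace ℝ F] {e : ℤ} {G : Rn n → F}
    (hG : ContDiff ℝ ∞ G)
    (h : ∀ l : ℕ, DilateDominated S (e + l) (iteratedFDeriv ℝ l G) U), ∀ x ∈ U,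
    HasFDerivAt (scaleIntegral S e G) (scaleIntegral S (e + 1) (fderiv ℝ G) x) x := by
    intro F _ _ e G hG h x hx
    refine hasFDerivAt_scaleIntegral hS hS0 (hG.of_le (by exact_mod_cast le_top)) ?_ ?_ hx
    · have := (h 0).congr_norm (G' := G) fun x => by simp
      simpa using this
    · have := (h 1).congr_norm (G' := fderiv ℝ G) fun x => by
        rw [← norm_iteratedFDeriv_fderiv, norm_iteratedFDeriv_zero]
      simpa using this
  induction l generalizing F e with
  | zero =>
    constructor
    · rw [Nat.cast_zero, contDiffOn_zero]
      exact fun x hx => (h1 hG h x hx).continuousAt.continuousWithinAt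
    · intro x hx
      simp only [iteratedFDeriv_zero_eq_comp, Function.comp_def, Nat.cast_zero, add_zero]
      exact (scaleIntegral_equiv_comp
        (continuousMultilinearCurryFin0 ℝ (Rn n) F).symm.toContinuousLinearEquiv S e G x).symm
  | succ l ih =>
    have hG' : ContDiff ℝ ∞ (fderiv ℝ G) := hG.fderiv_right (by norm_cast)
    have h' : ∀ l : ℕ, DilateDominated S (e + 1 + l) (iteratedFDeriv ℝ l (fderiv ℝ G)) U := by
      intro l
      have := (h (l + 1)).congr_norm (G' := iteratedFDeriv ℝ l (fderiv ℝ G))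
        fun x => norm_iteratedFDeriv_fderiv
      rwa [Nat.cast_succ, add_comm (l : ℤ) 1, ← add_assoc] at this
    obtain ⟨ih1, ih2⟩ := ih hG' h'
    have heq : ∀ x ∈ U, fderiv ℝ (scaleIntegral S e G) x =
        scaleIntegral S (e + 1) (fderiv ℝ G) x := fun x hx => (h1 hG h x hx).fderiv
    constructor
    · rw [Nat.cast_succ, contDiffOn_succ_iff_fderiv_of_isOpen hU]
      refine ⟨fun x hx => (h1 hG h x hx).differentiableAt.differentiableWithinAt, ?_,
        ih1.congr heq⟩
      intro h; exact absurd h (by exact_mod_cast WithTop.natCast_ne_top _)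
    · intro x hx
      have hev : fderiv ℝ (scaleIntegral S e G) =ᶠ[nhds x]
          scaleIntegral S (e + 1) (fderiv ℝ G) := by
        filter_upwards [hU.mem_nhds hx] with y hy using heq y hy
      rw [iteratedFDeriv_succ_eq_comp_right, Function.comp_apply,
        (hev.iteratedFDeriv ℝ l).self_of_nhds, ih2 x hx]
      have hG1 : iteratedFDeriv ℝ (l + 1) G = fun y =>
          (continuousMultilinearCurryRightEquiv' ℝ l (Rn n) F).symm.toContinuousLinearEquiv
            (iteratedFDeriv ℝ l (fderiv ℝ G) y) := by
        ext1 y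
        rw [iteratedFDeriv_succ_eq_comp_right]
        rfl
      rw [hG1, Nat.cast_succ, add_comm (l : ℤ) 1, ← add_assoc]
      exact (scaleIntegral_equiv_comp (F := (Rn n) [×l]→L[ℝ] (Rn n) →L[ℝ] F)
        (F' := (Rn n) [×(l + 1)]→L[ℝ] F) (continuousMultilinearCurryRightEquiv' ℝ l (Rn n) F).symm.toContinuousLinearEquiv
        S _ _ x).symm

end ScaleIntegral

/-! ### Bounds for small and large scales -/

section Domination
variable {n : ℕ} {F : Type*} [NormedAddCommGroup F] [NormedSpace ℝ F]

theorem exists_norm_dilate_le_of_vanishing {G : Rn n → F} (hG : ContDiff ℝ ∞ G) {N : ℕ}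
    (h0 : ∀ j < N, iteratedFDeriv ℝ j G 0 = 0) {e : ℤ} (he : 0 ≤ e + N) (r : ℝ) (l : ℕ) :
    ∃ C, 0 ≤ C ∧ ∀ s ∈ Set.Ioc (0 : ℝ) 1, ∀ x, ‖x‖ ≤ r →
      ‖s ^ (e + l) • iteratedFDeriv ℝ l G (s • x)‖ ≤ C := by
  obtain ⟨C, hC0, hC⟩ := exists_norm_iteratedFDeriv_le_of_vanishing hG h0 r l
  refine ⟨C * (max r 0) ^ (N - l), by positivity, fun s hs x hx => ?_⟩
  have hsx : ‖s • x‖ = s * ‖x‖ := by rw [norm_smul, Real.norm_of_nonneg hs.1.le]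
  have hsxr : ‖s • x‖ ≤ r := by
    rw [hsx]
    exact (mul_le_of_le_one_left (norm_nonneg _) hs.2).trans hx
  have h1 := hC (s • x) hsxr
  -- The total exponent e + l + (N - l) is at least e + N ≥ 0, also when l > N and the subtraction
  -- truncates.
  have h2 : s ^ (e + l) * s ^ (N - l) ≤ 1 := by
    rw [← zpow_natCast s (N - l), ← zpow_add₀ hs.1.ne']
    lift e + l + ((N - l : ℕ) : ℤ) to ℕ using by omega with p
    rw [zpow_natCast]
    exact pow_le_one₀ hs.1.le hs.2
  have h3 : ‖x‖ ^ (N - l) ≤ (max r 0) ^ (N - l) := by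
    gcongr
    exact hx.trans (le_max_left _ _)
  have hpos : 0 < s ^ (e + l) := zpow_pos hs.1 _
  rw [norm_smul, Real.norm_of_nonneg hpos.le]
  calc s ^ (e + l) * ‖iteratedFDeriv ℝ l G (s • x)‖
      ≤ s ^ (e + l) * (C * (s * ‖x‖) ^ (N - l)) := by
        rw [← hsx]; gcongr
    _ = (s ^ (e + l) * s ^ (N - l)) * (C * ‖x‖ ^ (N - l)) := by rw [mul_pow]; ring
    _ ≤ 1 * (C * (max r 0) ^ (N - l)) := by gcongr
    _ = _ := one_mul _

theorem dilateDominated_Ioc_of_vanishing {G : Rn n → F} (hG : ContDiff ℝ ∞ G) {N : ℕ}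
    (h0 : ∀ j < N, iteratedFDeriv ℝ j G 0 = 0) {e : ℤ} (he : 0 ≤ e + N) (l : ℕ) :
    DilateDominated (Set.Ioc 0 1) (e + l) (iteratedFDeriv ℝ l G) Set.univ := by
  intro x₀ _
  obtain ⟨C, _, hC⟩ := exists_norm_dilate_le_of_vanishing hG h0 he (‖x₀‖ + 1) l
  refine ⟨1, one_pos, fun _ => C, by simp, fun s hs x hx => hC s hs x ?_⟩
  have := norm_le_norm_add_norm_sub' x x₀
  rw [mem_ball_iff_norm] at hx
  linarith

theorem dilateDominated_Ioi (K : SchwartzMap (Rn n) F) (e : ℤ) (l : ℕ) :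
    DilateDominated (Set.Ioi 1) (e + l) (iteratedFDeriv ℝ l K) {0}ᶜ := by
  intro x₀ hx₀
  have hx₀' : 0 < ‖x₀‖ := norm_pos_iff.2 hx₀
  -- Decay of order p leaves s^(-2), which is integrable at infinity.
  set p := (e + l + 2).toNat with hp
  obtain ⟨C, hC0, hC⟩ := K.decay p l
  refine ⟨‖x₀‖ / 2, half_pos hx₀', fun s => C * ((‖x₀‖ / 2) ^ p)⁻¹ * s ^ (-2 : ℝ), ?_, ?_⟩
  · exact (integrableOn_Ioi_rpow_of_lt (by norm_num) one_pos).const_mul _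
  · intro s hs x hx
    have hs1 : (1 : ℝ) < s := hs
    have hs0 : 0 < s := one_pos.trans hs1
    have hxn : ‖x₀‖ / 2 ≤ ‖x‖ := by
      have := norm_le_norm_add_norm_sub' x₀ x
      rw [mem_ball_iff_norm'] at hx
      linarith
    have hsx : ‖s • x‖ = s * ‖x‖ := by rw [norm_smul, Real.norm_of_nonneg hs0.le]
    have h1 := hC (s • x)
    rw [hsx, mul_pow] at h1
    have h2 : s ^ (e + l) ≤ s ^ p * s ^ (-2 : ℤ) := by
      rw [← zpow_natCast s p, ← zpow_add₀ hs0.ne']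
      exact zpow_le_zpow_right₀ hs1.le (by omega)
    have h3 : s ^ (-2 : ℝ) = s ^ (-2 : ℤ) := by
      rw [← Real.rpow_intCast]; norm_num
    have hpos : 0 < s ^ (e + l) := zpow_pos hs0 _
    have hpos2 : 0 < s ^ (-2 : ℤ) := zpow_pos hs0 _
    beta_reduce
    rw [norm_smul, Real.norm_of_nonneg hpos.le, h3]
    set D := ‖iteratedFDeriv ℝ l K (s • x)‖
    have hD : 0 ≤ D := norm_nonneg _
    have h4 : (‖x₀‖ / 2) ^ p * (s ^ p * D) ≤ C :=
      calc (‖x₀‖ / 2) ^ p * (s ^ p * D) ≤ ‖x‖ ^ p * (s ^ p * D) := by gcongr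
        _ = s ^ p * ‖x‖ ^ p * D := by ring
        _ ≤ C := h1
    have h5 : s ^ p * D ≤ C * ((‖x₀‖ / 2) ^ p)⁻¹ := by
      rw [← div_eq_mul_inv, le_div_iff₀ (by positivity), mul_comm]
      exact h4
    calc s ^ (e + l) * D ≤ s ^ p * s ^ (-2 : ℤ) * D := by gcongr
      _ = s ^ p * D * s ^ (-2 : ℤ) := by ring
      _ ≤ _ := by gcongr

end Domination

/-! ### The regularized potential: smoothness and homogeneity -/

section Potential
variable {n : ℕ} {F : Type*} [NormedAddCommGroup F] [NormedSpace ℝ F]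

/-- `∫_0^∞ s^e (K(s x) - 1_{s ≤ 1} P(s x)) ds`. -/
def dilatePotential (e : ℤ) (K P : Rn n → F) (x : Rn n) : F :=
  scaleIntegral (Set.Ioc 0 1) e (K - P) x + scaleIntegral (Set.Ioi 1) e K x

variable {K : SchwartzMap (Rn n) F} {P : Rn n → F} {N : ℕ} {e : ℤ}

theorem iteratedFDeriv_sub_eq_zero_of_lt (hP : ContDiff ℝ ∞ P)
    (hPK : ∀ j < N, iteratedFDeriv ℝ j P 0 = iteratedFDeriv ℝ j K 0) :
    ∀ j < N, iteratedFDeriv ℝ j (⇑K - P) 0 = 0 := by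
  intro j hj
  rw [iteratedFDeriv_sub_apply (K.smooth _).contDiffAt
    (hP.of_le (by exact_mod_cast le_top)).contDiffAt, hPK j hj, sub_self]

theorem scaleIntegral_Ioc_contDiff_iteratedFDeriv (hP : ContDiff ℝ ∞ P)
    (hPK : ∀ j < N, iteratedFDeriv ℝ j P 0 = iteratedFDeriv ℝ j K 0) (he : 0 ≤ e + N) (l : ℕ) :
    ContDiff ℝ l (scaleIntegral (Set.Ioc 0 1) e (⇑K - P)) ∧ ∀ x,
      iteratedFDeriv ℝ l (scaleIntegral (Set.Ioc 0 1) e (⇑K - P)) x =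
        scaleIntegral (Set.Ioc 0 1) (e + l) (iteratedFDeriv ℝ l (⇑K - P)) x := by
  have hG : ContDiff ℝ ∞ (⇑K - P) := (K.smooth ⊤).sub hP
  have h := scaleIntegral_iteratedFDeriv (S := Set.Ioc 0 1) measurableSet_Ioc
    (fun s hs => hs.1.ne') isOpen_univ l (e := e) hG
    (dilateDominated_Ioc_of_vanishing hG (iteratedFDeriv_sub_eq_zero_of_lt hP hPK) he)
  exact ⟨contDiffOn_univ.1 h.1, fun x => h.2 x trivial⟩

theorem scaleIntegral_Ioi_contDiffOn_iteratedFDeriv (K : SchwartzMap (Rn n) F) (e : ℤ) (l : ℕ) :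
    ContDiffOn ℝ l (scaleIntegral (Set.Ioi 1) e K) {0}ᶜ ∧ ∀ x ∈ ({0}ᶜ : Set (Rn n)),
      iteratedFDeriv ℝ l (scaleIntegral (Set.Ioi 1) e K) x =
        scaleIntegral (Set.Ioi 1) (e + l) (iteratedFDeriv ℝ l K) x :=
  scaleIntegral_iteratedFDeriv (S := Set.Ioi 1) measurableSet_Ioi
    (fun _ hs => (one_pos.trans hs).ne') isOpen_compl_singleton l (K.smooth ⊤)
    (dilateDominated_Ioi K e)

theorem contDiffOn_dilatePotential (hP : ContDiff ℝ ∞ P)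
    (hPK : ∀ j < N, iteratedFDeriv ℝ j P 0 = iteratedFDeriv ℝ j K 0) (he : 0 ≤ e + N) :
    ContDiffOn ℝ ∞ (dilatePotential e K P) {0}ᶜ := by
  rw [contDiffOn_infty]
  intro l
  exact (scaleIntegral_Ioc_contDiff_iteratedFDeriv hP hPK he l).1.contDiffOn.add
    (scaleIntegral_Ioi_contDiffOn_iteratedFDeriv K e l).1

theorem iteratedFDeriv_eq_zero_of_le {P : Rn n → F} (hPN : ∀ x, iteratedFDeriv ℝ N P x = 0) {l : ℕ}
    (hl : N ≤ l) (x : Rn n) : iteratedFDeriv ℝ l P x = 0 := by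
  induction l, hl using Nat.le_induction generalizing x with
  | base => exact hPN x
  | succ l _ ih =>
    have : iteratedFDeriv ℝ l P = fun _ => 0 := funext ih
    rw [iteratedFDeriv_succ_eq_comp_left, this, Function.comp_apply, fderiv_fun_const]
    exact LinearIsometryEquiv.map_zero _

/-- Differentiating at least N times removes P, so the split at s = 1, which alone breaks scale
invariance, disappears. -/
theorem iteratedFDeriv_dilatePotential (hP : ContDiff ℝ ∞ P)
    (hPN : ∀ x, iteratedFDeriv ℝ N P x = 0)
    (hPK : ∀ j < N, iteratedFDeriv ℝ j P 0 = iteratedFDeriv ℝ j K 0) (he : 0 ≤ e + N) {l : ℕ}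
    (hl : N ≤ l) {x : Rn n} (hx : x ≠ 0) :
    iteratedFDeriv ℝ l (dilatePotential e K P) x =
      scaleIntegral (Set.Ioi 0) (e + l) (iteratedFDeriv ℝ l K) x := by
  obtain ⟨h1, h2⟩ := scaleIntegral_Ioc_contDiff_iteratedFDeriv hP hPK he l
  obtain ⟨h3, h4⟩ := scaleIntegral_Ioi_contDiffOn_iteratedFDeriv K e l
  have hKP : iteratedFDeriv ℝ l (⇑K - P) = iteratedFDeriv ℝ l K := by
    ext1 y
    rw [iteratedFDeriv_sub_apply (K.smooth _).contDiffAt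
      (hP.of_le (by exact_mod_cast le_top)).contDiffAt, iteratedFDeriv_eq_zero_of_le hPN hl,
      sub_zero]
  have hG : ContDiff ℝ ∞ (⇑K - P) := (K.smooth ⊤).sub hP
  have hcont : Continuous (iteratedFDeriv ℝ l K) :=
    (K.smooth ⊤).continuous_iteratedFDeriv (by exact_mod_cast le_top)
  have hadd : iteratedFDeriv ℝ l (dilatePotential e K P) x =
      iteratedFDeriv ℝ l (scaleIntegral (Set.Ioc 0 1) e (⇑K - P)) x +
        iteratedFDeriv ℝ l (scaleIntegral (Set.Ioi 1) e K) x :=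
    iteratedFDeriv_add_apply h1.contDiffAt (h3.contDiffAt (isOpen_compl_singleton.mem_nhds hx))
  rw [hadd, h2, h4 x hx, hKP, scaleIntegral, scaleIntegral, scaleIntegral,
    ← Set.Ioc_union_Ioi_eq_Ioi (zero_le_one (α := ℝ)), setIntegral_union
      (Set.Ioc_disjoint_Ioi le_rfl) measurableSet_Ioi]
  · have := (dilateDominated_Ioc_of_vanishing hG (iteratedFDeriv_sub_eq_zero_of_lt hP hPK) he
      l).integrableOn measurableSet_Ioc (by rw [hKP]; exact hcont) (Set.mem_univ x)
    rwa [hKP] at this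
  · exact (dilateDominated_Ioi K e l).integrableOn measurableSet_Ioi hcont hx

theorem scaleIntegral_Ioi_zero_smul (e : ℤ) (G : Rn n → F) {t : ℝ} (ht : 0 < t) (x : Rn n) :
    scaleIntegral (Set.Ioi 0) e G (t • x) =
      t ^ (-e - 1) • scaleIntegral (Set.Ioi 0) e G x := by
  have h := integral_comp_mul_left_Ioi (fun s : ℝ => s ^ e • G (s • x)) 0 ht
  rw [mul_zero] at h
  have h2 : ∀ s : ℝ, s ^ e • G (s • t • x) =
      t ^ (-e) • ((fun s : ℝ => s ^ e • G (s • x)) (t * s)) := by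
    intro s
    simp only
    rw [smul_smul, smul_smul, mul_comm s t, mul_zpow, ← mul_assoc, ← zpow_add₀ ht.ne',
      neg_add_cancel, zpow_zero, one_mul]
  simp only [scaleIntegral, h2]
  rw [integral_smul, h, smul_smul, zpow_sub_one₀ ht.ne']

theorem isHomogeneous_iteratedFDeriv_dilatePotential (hP : ContDiff ℝ ∞ P)
    (hPN : ∀ x, iteratedFDeriv ℝ N P x = 0)
    (hPK : ∀ j < N, iteratedFDeriv ℝ j P 0 = iteratedFDeriv ℝ j K 0) (he : 0 ≤ e + N) {l : ℕ}
    (hl : N ≤ l) :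
    IsHomogeneousAwayFromZero (-e - l - 1) (iteratedFDeriv ℝ l (dilatePotential e K P)) := by
  intro x hx t ht
  rw [iteratedFDeriv_dilatePotential hP hPN hPK he hl hx,
    iteratedFDeriv_dilatePotential hP hPN hPK he hl (smul_ne_zero ht.ne' hx),
    scaleIntegral_Ioi_zero_smul _ _ ht, neg_add, sub_eq_add_neg (-e) (l : ℤ)]

end Potential

/-! ### Local integrability and pairing with test functions -/

section Pairing
variable {n : ℕ} {F : Type*} [NormedAddCommGroup F] [NormedSpace ℝ F]

theorem aestronglyMeasurable_dilate_prod {G : Rn n → F} (hG : Continuous G) (S : Set ℝ) (e : ℤ) :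
    AEStronglyMeasurable (fun p : ℝ × Rn n => p.1 ^ e • G (p.1 • p.2))
      ((volume.restrict S).prod volume) := by
  refine AEStronglyMeasurable.smul ?_ ?_
  · exact (Measurable.pow_const measurable_fst e).aestronglyMeasurable
  · exact (hG.comp (by fun_prop)).aestronglyMeasurable

/-- The L¹ norm of s^e K(s·) is s^(e-n)‖K‖₁. For e = n-k-1 the exponent is -k-1, which is below -1
because k ≥ 1. -/
theorem integrable_dilate_Ioi (K : SchwartzMap (Rn n) F) {e : ℤ} (he : e - n < -1) :
    Integrable (fun p : ℝ × Rn n => p.1 ^ e • K (p.1 • p.2))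
      ((volume.restrict (Set.Ioi 1)).prod volume) := by
  rw [integrable_prod_iff (aestronglyMeasurable_dilate_prod K.continuous _ e)]
  constructor
  · filter_upwards [ae_restrict_mem measurableSet_Ioi] with s hs
    exact (K.integrable.comp_smul (one_pos.trans hs).ne').smul _
  · have h : ∀ s ∈ Set.Ioi (1 : ℝ), ∫ x : Rn n, ‖s ^ e • K (s • x)‖ =
        s ^ (((e - n : ℤ) : ℝ)) * ∫ x, ‖K x‖ := by
      intro s hs
      have hs0 : 0 < s := one_pos.trans hs
      simp only [norm_smul]
      rw [integral_const_mul, Measure.integral_comp_smul volume (fun x => ‖K x‖) s,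
        finrank_euclideanSpace_fin, smul_eq_mul, ← mul_assoc, Real.rpow_intCast,
        abs_of_pos (by positivity), Real.norm_of_nonneg (zpow_pos hs0 e).le, zpow_sub₀ hs0.ne',
        zpow_natCast, div_eq_mul_inv]
    refine IntegrableOn.congr_fun (f := fun s : ℝ => s ^ (((e - n : ℤ) : ℝ)) * ∫ x, ‖K x‖) ?_
      (fun s hs => (h s hs).symm) measurableSet_Ioi
    refine (integrableOn_Ioi_rpow_of_lt ?_ one_pos).mul_const _
    exact_mod_cast he

theorem integrable_dilate_Ioc {G : Rn n → F} (hG : ContDiff ℝ ∞ G) {N : ℕ}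
    (h0 : ∀ j < N, iteratedFDeriv ℝ j G 0 = 0) {e : ℤ} (he : 0 ≤ e + N) {g : Rn n → ℝ}
    (hg : Continuous g) (hgc : HasCompactSupport g) :
    Integrable (fun p : ℝ × Rn n => g p.2 • p.1 ^ e • G (p.1 • p.2))
      ((volume.restrict (Set.Ioc 0 1)).prod volume) := by
  obtain ⟨r, hr⟩ := hgc.isBounded.exists_norm_le
  obtain ⟨C, hC0, hC⟩ := exists_norm_dilate_le_of_vanishing hG h0 he r 0
  have hbound : Integrable (fun p : ℝ × Rn n => C * ‖g p.2‖)
      ((volume.restrict (Set.Ioc 0 1)).prod volume) :=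
    Integrable.mul_prod (f := fun _ : ℝ => C) (g := fun x => ‖g x‖) (by simp)
      (hg.integrable_of_hasCompactSupport hgc).norm
  refine hbound.mono' ?_ ?_
  · exact (hg.comp continuous_snd).aestronglyMeasurable.smul
      (aestronglyMeasurable_dilate_prod hG.continuous _ e)
  · have hae : ∀ᵐ p : ℝ × Rn n ∂((volume.restrict (Set.Ioc 0 1)).prod volume),
        p.1 ∈ Set.Ioc (0 : ℝ) 1 :=
      Measure.quasiMeasurePreserving_fst.ae (ae_restrict_mem measurableSet_Ioc)
    filter_upwards [hae] with p hp
    by_cases hgp : g p.2 = 0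
    · simp [hgp]
    · have h1 := hC p.1 hp p.2 (hr _ (subset_tsupport g hgp))
      rw [norm_smul, norm_iteratedFDeriv_zero, ← norm_smul, Nat.cast_zero, add_zero] at h1
      rw [norm_smul, mul_comm]
      gcongr

theorem integrable_smul_dilate_Ioi (K : SchwartzMap (Rn n) F) {e : ℤ} (he : e - n < -1)
    {g : Rn n → ℝ} (hg : Continuous g) (hgc : HasCompactSupport g) :
    Integrable (fun p : ℝ × Rn n => g p.2 • p.1 ^ e • K (p.1 • p.2))
      ((volume.restrict (Set.Ioi 1)).prod volume) := by
  obtain ⟨C, hC⟩ := hg.bounded_above_of_compact_support hgc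
  exact (integrable_dilate_Ioi K he).bdd_smul C (φ := fun p : ℝ × Rn n => g p.2)
    (hg.comp continuous_snd).aestronglyMeasurable (Filter.Eventually.of_forall fun p => hC p.2)

variable {K : SchwartzMap (Rn n) F} {P : Rn n → F} {N : ℕ} {e : ℤ}

theorem locallyIntegrable_dilatePotential (hP : ContDiff ℝ ∞ P)
    (hPK : ∀ j < N, iteratedFDeriv ℝ j P 0 = iteratedFDeriv ℝ j K 0) (he : 0 ≤ e + N)
    (he' : e - n < -1) : LocallyIntegrable (dilatePotential e K P) :=
  (scaleIntegral_Ioc_contDiff_iteratedFDeriv hP hPK he 0).1.continuous.locallyIntegrable.add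
    (integrable_dilate_Ioi K he').integral_prod_right.locallyIntegrable

theorem integrableOn_integral_smul_dilate {S : Set ℝ} {G : Rn n → F} {g : Rn n → ℝ}
    (h : Integrable (fun p : ℝ × Rn n => g p.2 • p.1 ^ e • G (p.1 • p.2))
      ((volume.restrict S).prod volume)) :
    IntegrableOn (fun s : ℝ => s ^ e • ∫ x, g x • G (s • x)) S := by
  have := h.integral_prod_left
  simp only [smul_comm (g _)] at this
  rw [IntegrableOn]
  simpa only [integral_smul] using this

theorem integral_smul_scaleIntegral {S : Set ℝ} {G : Rn n → F} {g : Rn n → ℝ}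
    (h : Integrable (fun p : ℝ × Rn n => g p.2 • p.1 ^ e • G (p.1 • p.2))
      ((volume.restrict S).prod volume)) :
    ∫ x, g x • scaleIntegral S e G x = ∫ s in S, s ^ e • ∫ x, g x • G (s • x) := by
  have h1 := integral_integral_swap (f := fun (s : ℝ) (x : Rn n) => g x • s ^ e • G (s • x)) h
  simp only [scaleIntegral, ← integral_smul]
  rw [← h1]
  simp only [smul_comm (g _)]

theorem integral_smul_dilatePotential (hP : ContDiff ℝ ∞ P)
    (hPK : ∀ j < N, iteratedFDeriv ℝ j P 0 = iteratedFDeriv ℝ j K 0) (he : 0 ≤ e + N)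
    (he' : e - n < -1) {g : Rn n → ℝ} (hg : Continuous g) (hgc : HasCompactSupport g) :
    ∫ x, g x • dilatePotential e K P x =
      (∫ s in Set.Ioc (0 : ℝ) 1, s ^ e • ∫ x, g x • (⇑K - P) (s • x)) +
        ∫ s in Set.Ioi (1 : ℝ), s ^ e • ∫ x, g x • K (s • x) := by
  have hG : ContDiff ℝ ∞ (⇑K - P) := (K.smooth ⊤).sub hP
  have h1 := integrable_dilate_Ioc hG (iteratedFDeriv_sub_eq_zero_of_lt hP hPK) he hg hgc
  have h2 := integrable_smul_dilate_Ioi K he' hg hgc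
  rw [← integral_smul_scaleIntegral h1, ← integral_smul_scaleIntegral h2, ← integral_add]
  · simp only [dilatePotential, smul_add]
  · have := h1.integral_prod_right
    simpa only [scaleIntegral, integral_smul] using this
  · have := h2.integral_prod_right
    simpa only [scaleIntegral, integral_smul] using this

end Pairing

/-! ### Iterated partial derivatives and integration by parts -/

section IteratedPartial
variable {n : ℕ} {F : Type*} [NormedAddCommGroup F] [NormedSpace ℝ F]

/-- The iterated partial derivative along a list of coordinates, applied from the head. -/
def iterPartial : List (Fin n) → (Rn n → F) → Rn n → F
  | [], G => G
  | i :: L, G => iterPartial L (fun x => fderiv ℝ G x (stdVec i))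

theorem contDiff_partial {G : Rn n → F} (hG : ContDiff ℝ ∞ G) (v : Rn n) :
    ContDiff ℝ ∞ (fun x => fderiv ℝ G x v) :=
  (hG.fderiv_right (by norm_cast)).clm_apply contDiff_const

theorem iterPartial_sub (L : List (Fin n)) {G H : Rn n → F} (hG : ContDiff ℝ ∞ G)
    (hH : ContDiff ℝ ∞ H) : iterPartial L (G - H) = iterPartial L G - iterPartial L H := by
  induction L generalizing G H with
  | nil => rfl
  | cons i L ih =>
    have : (fun x => fderiv ℝ (G - H) x (stdVec i)) =
        (fun x => fderiv ℝ G x (stdVec i)) - fun x => fderiv ℝ H x (stdVec i) := by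
      ext1 x
      rw [fderiv_sub (hG.differentiable (by simp) x) (hH.differentiable (by simp) x)]
      rfl
    rw [iterPartial, this, ih (contDiff_partial hG _) (contDiff_partial hH _)]
    rfl

theorem iterPartial_eq_zero (L : List (Fin n)) {P : Rn n → F} (hP : ContDiff ℝ ∞ P)
    (h : ∀ x, iteratedFDeriv ℝ L.length P x = 0) : iterPartial L P = 0 := by
  induction L generalizing P with
  | nil =>
    ext1 x
    have := h x
    rw [← norm_eq_zero, List.length_nil, norm_iteratedFDeriv_zero, norm_eq_zero] at this
    exact this
  | cons i L ih =>
    refine ih (contDiff_partial hP _) fun x => ?_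
    have h1 : iteratedFDeriv ℝ L.length (fderiv ℝ P) x = 0 := by
      rw [← norm_eq_zero, norm_iteratedFDeriv_fderiv, norm_eq_zero]
      exact h x
    have hP' : ContDiff ℝ ∞ (fderiv ℝ P) := hP.fderiv_right (by norm_cast)
    have h2 := (ContinuousLinearMap.apply ℝ F (stdVec i)).iteratedFDeriv_comp_left
      (hP'.contDiffAt (x := x)) (i := L.length) (by exact_mod_cast le_top)
    rw [h1] at h2
    refine Eq.trans h2 ?_
    ext v
    simp

/-- Each integration by parts costs a sign and a factor s from the dilation. -/
theorem integral_polyAction_smul_dilate (L : List (Fin n)) {G : Rn n → F} (hG : ContDiff ℝ ∞ G)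
    (s : ℝ) (f : 𝓓((⊤ : TopologicalSpace.Opens (Rn n)), ℝ)) :
    ∫ x, polyAction ((L.map MvPolynomial.X).prod) f x • G (s • x) =
      ((-1) ^ L.length * s ^ L.length) • ∫ x, f x • iterPartial L G (s • x) := by
  induction L generalizing G with
  | nil => simp [iterPartial]
  | cons i L ih =>
    set g := polyAction ((L.map MvPolynomial.X).prod) f with hg
    have hg1 : polyAction (((i :: L).map MvPolynomial.X).prod) f = ∂_{stdVec i} g := by
      rw [List.map_cons, List.prod_cons, polyAction_mul_apply, polyAction_X, partialEnd_apply]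
    rw [hg1, iterPartial]
    have hGs : ∀ x, HasFDerivAt (fun x => G (s • x)) _ x := fun x =>
      (hG.differentiable (by simp) (s • x)).hasFDerivAt.comp x ((hasFDerivAt_id x).const_smul s)
    have hcG : Continuous fun x : Rn n => G (s • x) := hG.continuous.comp (by fun_prop)
    have hcG' : Continuous fun x : Rn n => s • fderiv ℝ G (s • x) (stdVec i) :=
      ((contDiff_partial hG _).continuous.comp (by fun_prop)).const_smul s
    have hint : ∀ (g : 𝓓((⊤ : TopologicalSpace.Opens (Rn n)), ℝ)) {H : Rn n → F},
        Continuous H → Integrable (fun x => g x • H x) := fun g H hH =>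
      (g.continuous.smul hH).integrable_of_hasCompactSupport g.hasCompactSupport.smul_right
    have hparts := integral_bilinear_hasLineDerivAt_right_eq_neg_left_of_integrable
      (μ := volume) (B := ContinuousLinearMap.lsmul ℝ ℝ) (f := g)
      (f' := fun x => (∂_{stdVec i} g : 𝓓((⊤ : TopologicalSpace.Opens (Rn n)), ℝ)) x)
      (g := fun x => G (s • x)) (g' := fun x => s • fderiv ℝ G (s • x) (stdVec i)) (v := stdVec i)
      (hint (∂_{stdVec i} g) hcG) (hint g hcG') (hint g hcG)
      (fun x _ => by
        rw [lineDeriv_testFunction_apply]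
        exact ((g.contDiff.differentiable (by simp) x).hasFDerivAt).hasLineDerivAt _)
      (fun x _ => by
        have := (hGs x).hasLineDerivAt (stdVec i)
        simpa using this)
    simp only [ContinuousLinearMap.lsmul_apply] at hparts
    have h2 : ∫ x, (∂_{stdVec i} g) x • G (s • x) =
        -(s • ∫ x, g x • (fun y => fderiv ℝ G y (stdVec i)) (s • x)) := by
      rw [← integral_smul, eq_neg_iff_add_eq_zero, add_comm, ← eq_neg_iff_add_eq_zero, ← hparts]
      simp only [smul_comm s]
    rw [h2, ih (contDiff_partial hG _), smul_smul, ← neg_smul, List.length_cons, pow_succ, pow_succ]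
    congr 1
    ring

/-- The list of coordinates in which `i` occurs `α i` times. -/
def multiIndexList (α : Fin n → ℕ) : List (Fin n) :=
  (List.finRange n).flatMap fun i => List.replicate (α i) i

theorem length_multiIndexList (α : Fin n → ℕ) : (multiIndexList α).length = ∑ i, α i := by
  simp [multiIndexList, List.length_flatMap, Fin.sum_univ_def]

theorem prod_map_multiIndexList {M : Type*} [CommMonoid M] (α : Fin n → ℕ) (a : Fin n → M) :
    ((multiIndexList α).map a).prod = ∏ i, a i ^ α i := by
  rw [multiIndexList, Fin.prod_univ_def]
  induction List.finRange n with
  | nil => simp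
  | cons i L ih => simp [ih]

theorem length_multiIndexList_of_mem {k : ℕ} {α : Fin n → ℕ} (hα : α ∈ multiIndices n k) :
    (multiIndexList α).length = k := by
  rw [length_multiIndexList]
  simpa using (Finset.mem_piAntidiag.1 hα).1

end IteratedPartial

section Pairing
variable {n : ℕ} {F : Type*} [NormedAddCommGroup F] [NormedSpace ℝ F]
variable {K : SchwartzMap (Rn n) F} {P : Rn n → F} {N k : ℕ}

/-- The k derivatives raise the exponent from n-k-1 to n-1 and kill P, since N ≤ k; the two ranges
of s then merge into one integral. -/
theorem integral_polyAction_smul_dilatePotential (hn : 1 ≤ n) (hk : 1 ≤ k) (hP : ContDiff ℝ ∞ P)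
    (hPN : ∀ x, iteratedFDeriv ℝ N P x = 0)
    (hPK : ∀ j < N, iteratedFDeriv ℝ j P 0 = iteratedFDeriv ℝ j K 0) (hN : k + 1 ≤ n + N)
    (hNk : N ≤ k) (L : List (Fin n)) (hL : L.length = k)
    (f : 𝓓((⊤ : TopologicalSpace.Opens (Rn n)), ℝ)) :
    IntegrableOn (fun s : ℝ => s ^ (n - 1) • ∫ x, f x • iterPartial L K (s • x)) (Set.Ioi 0) ∧
    ∫ x, polyAction ((L.map MvPolynomial.X).prod) f x •
        dilatePotential ((n : ℤ) - k - 1) K P x =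
      (-1 : ℝ) ^ k • ∫ s in Set.Ioi (0 : ℝ), s ^ (n - 1) • ∫ x, f x • iterPartial L K (s • x) := by
  set e : ℤ := (n : ℤ) - k - 1 with he
  set g := polyAction ((L.map MvPolynomial.X).prod) f with hg
  have he1 : 0 ≤ e + N := by omega
  have he2 : e - n < -1 := by omega
  have hG : ContDiff ℝ ∞ (⇑K - P) := (K.smooth ⊤).sub hP
  have hiter : iterPartial L (⇑K - P) = iterPartial L K := by
    rw [iterPartial_sub L (K.smooth ⊤) hP, iterPartial_eq_zero L hP, sub_zero]
    intro x
    exact iteratedFDeriv_eq_zero_of_le hPN (by omega) x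
  have hexp : ∀ s : ℝ, 0 < s → ∀ G : Rn n → F, ContDiff ℝ ∞ G → iterPartial L G = iterPartial L K →
      s ^ e • ∫ x, g x • G (s • x) =
        (-1 : ℝ) ^ k • s ^ (n - 1) • ∫ x, f x • iterPartial L K (s • x) := by
    intro s hs G hG' hGK
    rw [hg, integral_polyAction_smul_dilate L hG', hGK, smul_smul, smul_smul, hL]
    congr 1
    have : s ^ e * s ^ k = s ^ (n - 1) := by
      rw [← zpow_natCast s k, ← zpow_add₀ hs.ne', ← zpow_natCast s (n - 1)]
      congr 1
      omega
    rw [← this]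
    ring
  have hgc := g.hasCompactSupport
  have h1 := integrableOn_integral_smul_dilate
    (integrable_dilate_Ioc hG (iteratedFDeriv_sub_eq_zero_of_lt hP hPK) he1 g.continuous hgc)
  have h2 := integrableOn_integral_smul_dilate (integrable_smul_dilate_Ioi K he2 g.continuous hgc)
  have e1 : Set.EqOn (fun s : ℝ => s ^ e • ∫ x, g x • (⇑K - P) (s • x))
      (fun s => (-1 : ℝ) ^ k • s ^ (n - 1) • ∫ x, f x • iterPartial L K (s • x))
      (Set.Ioc 0 1) := fun s hs => hexp s hs.1 _ hG hiter
  have e2 : Set.EqOn (fun s : ℝ => s ^ e • ∫ x, g x • K (s • x))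
      (fun s => (-1 : ℝ) ^ k • s ^ (n - 1) • ∫ x, f x • iterPartial L K (s • x))
      (Set.Ioi 1) := fun s hs => hexp s (one_pos.trans hs) _ (K.smooth ⊤) rfl
  have h1' := h1.congr_fun e1 measurableSet_Ioc
  have h2' := h2.congr_fun e2 measurableSet_Ioi
  have h3 := h1'.union h2'
  rw [Set.Ioc_union_Ioi_eq_Ioi (zero_le_one (α := ℝ))] at h3
  constructor
  · have h4 := Integrable.smul ((-1 : ℝ) ^ k) h3
    refine IntegrableOn.congr_fun h4 (fun s _ => ?_) measurableSet_Ioi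
    simp only [Pi.smul_apply, smul_smul, ← mul_assoc, ← mul_pow]
    norm_num
  · rw [integral_smul_dilatePotential hP hPK he1 he2 g.continuous hgc,
      setIntegral_congr_fun measurableSet_Ioc e1, setIntegral_congr_fun measurableSet_Ioi e2,
      ← setIntegral_union (Set.Ioc_disjoint_Ioi le_rfl) measurableSet_Ioi h1' h2',
      Set.Ioc_union_Ioi_eq_Ioi (zero_le_one (α := ℝ)), integral_smul]

end Pairing

/-! ### The Dirac mass as a superposition of dilates -/

section DeltaLimit
variable {n : ℕ}

/-- The function `y ↦ n X(y) + DX(y) y`, the divergence of `y ↦ X(y) y`. -/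
def radialDiv (X : Rn n → ℝ) (y : Rn n) : ℝ := n * X y + fderiv ℝ X y y

theorem continuous_radialDiv {X : Rn n → ℝ} (hX : ContDiff ℝ ∞ X) : Continuous (radialDiv X) :=
  (continuous_const.mul hX.continuous).add
    ((hX.continuous_fderiv (by simp)).clm_apply continuous_id)

theorem hasDerivAt_pow_mul_dilate (hn : 1 ≤ n) {X : Rn n → ℝ} (hX : ContDiff ℝ ∞ X) (x : Rn n)
    (s : ℝ) : HasDerivAt (fun s : ℝ => s ^ n * X (s • x)) (s ^ (n - 1) * radialDiv X (s • x)) s := by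
  have h1 : HasDerivAt (fun s : ℝ => s • x) ((1 : ℝ) • x) s := (hasDerivAt_id s).smul_const x
  have h2 : HasDerivAt (fun s : ℝ => X (s • x)) _ s :=
    ((hX.differentiable (by simp) (s • x)).hasFDerivAt).comp_hasDerivAt s h1
  have h3 := (hasDerivAt_pow n s).mul h2
  refine h3.congr_deriv ?_
  obtain ⟨m, rfl⟩ : ∃ m, n = m + 1 := ⟨n - 1, by omega⟩
  simp only [radialDiv, map_smul, smul_eq_mul, one_smul, Nat.add_sub_cancel]
  ring

theorem intervalIntegral_smul_radialDiv (hn : 1 ≤ n) {X : Rn n → ℝ} (hX : ContDiff ℝ ∞ X)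
    {f : Rn n → ℝ} (hf : Continuous f) (hfc : HasCompactSupport f) {R : ℝ} (hR : 0 ≤ R) :
    ∫ s in (0 : ℝ)..R, s ^ (n - 1) * ∫ x, f x * radialDiv X (s • x) =
      R ^ n * ∫ x, f x * X (R • x) := by
  have hc : Continuous fun p : ℝ × Rn n => f p.2 * (p.1 ^ (n - 1) * radialDiv X (p.1 • p.2)) :=
    (hf.comp continuous_snd).mul ((continuous_fst.pow _).mul
      ((continuous_radialDiv hX).comp (by fun_prop)))
  have hint : Integrable (fun p : ℝ × Rn n => f p.2 * (p.1 ^ (n - 1) * radialDiv X (p.1 • p.2)))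
      ((volume.restrict (Set.Ioc 0 R)).prod volume) := by
    have h1 := hc.continuousOn.integrableOn_compact (μ := volume.prod volume)
      (isCompact_Icc (a := (0 : ℝ)) (b := R) |>.prod hfc)
    have h2 : IntegrableOn (fun p : ℝ × Rn n => f p.2 * (p.1 ^ (n - 1) * radialDiv X (p.1 • p.2)))
        (Set.Icc 0 R ×ˢ Set.univ) (volume.prod volume) := by
      refine h1.of_forall_sdiff_eq_zero (measurableSet_Icc.prod .univ) fun p hp => ?_
      have : p.2 ∉ tsupport f := fun h => hp.2 ⟨hp.1.1, h⟩
      rw [image_eq_zero_of_notMem_tsupport this, zero_mul]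
    have h3 := h2.mono_set (Set.prod_mono Set.Ioc_subset_Icc_self subset_rfl)
    rwa [IntegrableOn, ← Measure.prod_restrict, Measure.restrict_univ] at h3
  have h1 := integral_integral_swap
    (f := fun (s : ℝ) (x : Rn n) => f x * (s ^ (n - 1) * radialDiv X (s • x))) hint
  rw [intervalIntegral.integral_of_le hR]
  calc _ = ∫ s in Set.Ioc 0 R, ∫ x, f x * (s ^ (n - 1) * radialDiv X (s • x)) := by
        simp only [← integral_const_mul, mul_left_comm]
    _ = ∫ x, R ^ n * (f x * X (R • x)) := by
        rw [h1]
        congr 1 with x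
        rw [integral_const_mul, ← intervalIntegral.integral_of_le hR,
          intervalIntegral.integral_eq_sub_of_hasDerivAt
            (fun s _ => hasDerivAt_pow_mul_dilate hn hX x s)
            (Continuous.intervalIntegrable (by
              exact (continuous_pow _).mul ((continuous_radialDiv hX).comp (by fun_prop))) _ _),
          zero_pow (by omega)]
        ring
    _ = _ := integral_const_mul _ _

/-- Approximate identity: substituting y = Rx gives ∫ f(y/R) X(y) dy, and dominated convergence
applies. -/
theorem tendsto_integral_mul_dilate {X : Rn n → ℝ} (hX : Integrable X) {f : Rn n → ℝ}
    (hf : Continuous f) (hfc : HasCompactSupport f) :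
    Filter.Tendsto (fun R : ℝ => R ^ n * ∫ x, f x * X (R • x)) Filter.atTop
      (nhds (f 0 * ∫ x, X x)) := by
  obtain ⟨C, hC⟩ := hf.bounded_above_of_compact_support hfc
  have h1 : Filter.Tendsto (fun R : ℝ => ∫ y, f (R⁻¹ • y) * X y) Filter.atTop
      (nhds (∫ y, f 0 * X y)) := by
    refine tendsto_integral_filter_of_dominated_convergence (fun y => C * ‖X y‖) ?_ ?_
      (hX.norm.const_mul C) ?_
    · exact Filter.Eventually.of_forall fun R =>
        (hf.comp (by fun_prop : Continuous fun y : Rn n => R⁻¹ • y)).aestronglyMeasurable.mul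
          hX.aestronglyMeasurable
    · refine Filter.Eventually.of_forall fun R => Filter.Eventually.of_forall fun y => ?_
      rw [norm_mul]
      gcongr
      exact hC _
    · refine Filter.Eventually.of_forall fun y => ?_
      have : Filter.Tendsto (fun R : ℝ => R⁻¹ • y) Filter.atTop (nhds ((0 : ℝ) • y)) :=
        tendsto_inv_atTop_zero.smul_const y
      rw [zero_smul] at this
      exact ((hf.tendsto 0).comp this).mul_const _
  rw [integral_const_mul] at h1
  refine h1.congr' ?_
  filter_upwards [Filter.eventually_gt_atTop 0] with R hR
  have h2 := Measure.integral_comp_smul volume (fun y : Rn n => f (R⁻¹ • y) * X y) R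
  simp only [inv_smul_smul₀ hR.ne'] at h2
  rw [h2, finrank_euclideanSpace_fin, abs_of_pos (by positivity), smul_eq_mul,
    mul_inv_cancel_left₀ (by positivity)]

theorem integral_Ioi_smul_radialDiv (hn : 1 ≤ n) {X : Rn n → ℝ} (hX : ContDiff ℝ ∞ X)
    (hXi : Integrable X) {f : Rn n → ℝ} (hf : Continuous f) (hfc : HasCompactSupport f)
    (hint : IntegrableOn (fun s : ℝ => s ^ (n - 1) * ∫ x, f x * radialDiv X (s • x)) (Set.Ioi 0)) :
    ∫ s in Set.Ioi (0 : ℝ), s ^ (n - 1) * ∫ x, f x * radialDiv X (s • x) = f 0 * ∫ x, X x := by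
  refine tendsto_nhds_unique (intervalIntegral_tendsto_integral_Ioi 0 hint Filter.tendsto_id)
    ((tendsto_integral_mul_dilate hXi hf hfc).congr' ?_)
  filter_upwards [Filter.eventually_ge_atTop 0] with R hR
  exact (intervalIntegral_smul_radialDiv hn hX hf hfc hR).symm

end DeltaLimit

theorem continuous_iterPartial {n : ℕ} {V : Type*} [NormedAddCommGroup V] [NormedSpace ℝ V]
    (L : List (Fin n)) {G : Rn n → V} (hG : ContDiff ℝ ∞ G) :
    Continuous (iterPartial L G) := by
  induction L generalizing G with
  | nil => exact hG.continuous
  | cons i L ih => exact ih (contDiff_partial hG _)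

/-! ### The potential solves the equation -/

section Potential
variable {n k : ℕ} {V W : Type*} [NormedAddCommGroup V] [NormedSpace ℝ V] [FiniteDimensional ℝ V]
  [NormedAddCommGroup W] [NormedSpace ℝ W] [FiniteDimensional ℝ W]

theorem diffOp_dilatePotential (hn : 1 ≤ n) (hk : 1 ≤ k) {N : ℕ} (hN : k + 1 ≤ n + N) (hNk : N ≤ k)
    (B : (Fin n → ℕ) → V →L[ℝ] W) (K : SchwartzMap (Rn n) V) {P : Rn n → V} (hP : ContDiff ℝ ∞ P)
    (hPN : ∀ x, iteratedFDeriv ℝ N P x = 0)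
    (hPK : ∀ j < N, iteratedFDeriv ℝ j P 0 = iteratedFDeriv ℝ j K 0)
    (X : SchwartzMap (Rn n) ℝ) (hX : ∫ x, X x = 1) {w : W} (hw : w ≠ 0)
    (hK : ∀ x, ∑ α ∈ multiIndices n k, B α (iterPartial (multiIndexList α) K x) =
      radialDiv X x • w) :
    LocallyIntegrable (dilatePotential ((n : ℤ) - k - 1) K P) ∧
      diffOp k B (regularDistribution (dilatePotential ((n : ℤ) - k - 1) K P)) = diracVec w := by
  have hloc : LocallyIntegrable (dilatePotential ((n : ℤ) - k - 1) K P) :=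
    locallyIntegrable_dilatePotential hP hPK (by omega) (by omega)
  refine ⟨hloc, ?_⟩
  ext f
  have hf := f.continuous
  have hfc := f.hasCompactSupport
  have key := fun α (hα : α ∈ multiIndices n k) =>
    integral_polyAction_smul_dilatePotential (P := P) hn hk hP hPN hPK hN hNk (multiIndexList α)
      (length_multiIndexList_of_mem hα) f
  have hsum : ∀ s : ℝ, ∑ α ∈ multiIndices n k,
      B α (s ^ (n - 1) • ∫ x, f x • iterPartial (multiIndexList α) K (s • x)) =
        (s ^ (n - 1) * ∫ x, f x * radialDiv X (s • x)) • w := by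
    intro s
    have hi : ∀ α, Integrable fun x => f x • iterPartial (multiIndexList α) K (s • x) := fun α =>
      (hf.smul ((continuous_iterPartial _ (K.smooth ⊤)).comp
        (by fun_prop))).integrable_of_hasCompactSupport hfc.smul_right
    simp only [map_smul]
    rw [← Finset.smul_sum, mul_smul, ← integral_smul_const]
    congr 1
    calc _ = ∑ α ∈ multiIndices n k,
          ∫ x, B α (f x • iterPartial (multiIndexList α) K (s • x)) :=
          Finset.sum_congr rfl fun α _ => ((B α).integral_comp_comm (hi α)).symm
      _ = _ := by
          rw [← integral_finsetSum _ fun α _ => (B α).integrable_comp (hi α)]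
          congr 1 with x
          simp only [map_smul]
          rw [← Finset.smul_sum, hK, mul_smul]
  have hint : IntegrableOn (fun s : ℝ => (s ^ (n - 1) * ∫ x, f x * radialDiv X (s • x)) • w)
      (Set.Ioi 0) := by
    simp only [← hsum]
    exact integrable_finsetSum _ fun α hα => (B α).integrable_comp (key α hα).1
  -- Because w ≠ 0, integrability of the vector integrand descends to its scalar factor.
  have hint' := (integrable_smul_const hw).1 hint
  rw [diffOp_apply, diracVec_apply]
  calc _ = ∑ α ∈ multiIndices n k, B α (∫ s in Set.Ioi (0 : ℝ),
        s ^ (n - 1) • ∫ x, f x • iterPartial (multiIndexList α) K (s • x)) := by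
        rw [Finset.smul_sum]
        refine Finset.sum_congr rfl fun α hα => ?_
        have hmon : ((multiIndexList α).map MvPolynomial.X).prod = monom α :=
          prod_map_multiIndexList α _
        rw [regularDistribution_apply hloc, ← hmon, (key α hα).2, map_smul, smul_smul, ← mul_pow]
        norm_num
    _ = ∫ s in Set.Ioi (0 : ℝ), (s ^ (n - 1) * ∫ x, f x * radialDiv X (s • x)) • w := by
        simp only [← hsum]
        rw [integral_finsetSum _ fun α hα => (B α).integrable_comp (key α hα).1]
        exact Finset.sum_congr rfl fun α hα => ((B α).integral_comp_comm (key α hα).1).symm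
    _ = f 0 • w := by
        rw [integral_smul_const,
          integral_Ioi_smul_radialDiv hn (X.smooth ⊤) X.integrable hf hfc hint', hX, mul_one]

end Potential

/-! ### Smooth solution v of 𝔹(ξ)v(ξ) = w off the origin -/

section SymbolSection
variable {n k : ℕ} {V W : Type*} [NormedAddCommGroup V] [NormedSpace ℝ V] [FiniteDimensional ℝ V]
  [NormedAddCommGroup W] [NormedSpace ℝ W] [FiniteDimensional ℝ W]

theorem contDiff_eval_mvPolynomial (p : MvPolynomial (Fin n) ℝ) :
    ContDiff ℝ ∞ fun ξ : Rn n => MvPolynomial.eval ξ p := by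
  induction p using MvPolynomial.induction_on with
  | C a => simpa using contDiff_const
  | add p q hp hq => simpa using hp.add hq
  | mul_X p i hp =>
    simp only [map_mul, MvPolynomial.eval_X]
    exact hp.mul (by fun_prop)

theorem exists_contDiffOn_symbol_eq (hn : 1 ≤ n) {B : (Fin n → ℕ) → V →L[ℝ] W}
    (hB : IsConstantRank k B) {w : W} (hw : w ∈ commonRange k B) :
    ∃ v : Rn n → V, ContDiffOn ℝ ∞ v {0}ᶜ ∧ ∀ ξ : Rn n, ξ ≠ 0 → symbol k B ξ (v ξ) = w := by
  set bV := Module.finBasis ℝ V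
  set bW := Module.finBasis ℝ W
  obtain ⟨A, D, c, hA, hD, hc⟩ := hB.exists_annihilator_parametrix hn bV bW
  refine ⟨fun ξ => (MvPolynomial.eval ξ c)⁻¹ •
    bV.equivFun.symm ((D.map (MvPolynomial.eval ξ)).mulVec (bW.equivFun w)), ?_, ?_⟩
  · refine ContDiffOn.smul (ContDiffOn.inv (contDiff_eval_mvPolynomial c).contDiffOn
      fun ξ hξ => hc ξ (by simpa using hξ)) (ContDiff.contDiffOn ?_)
    refine bV.equivFun.symm.toLinearMap.toContinuousLinearMap.contDiff.comp ?_
    refine contDiff_pi.2 fun i => ?_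
    simp only [Matrix.mulVec, dotProduct, Matrix.map_apply]
    exact ContDiff.sum fun j _ => (contDiff_eval_mvPolynomial _).mul contDiff_const
  · intro ξ hξ
    obtain ⟨v, hv⟩ := mem_commonRange_iff.1 hw ξ hξ
    have h0 : (A.map (MvPolynomial.eval ξ)).mulVec (bW.equivFun w) = 0 := by
      have h1 := symbol_equivFun_symm bV bW k B ξ (bV.equivFun v)
      rw [LinearEquiv.symm_apply_apply] at h1
      rw [← hv, ContinuousLinearMap.coe_coe, h1, Matrix.mulVec_mulVec, ← Matrix.map_mul, hA]
      simp
    rw [map_smul, symbol_parametrix_apply bV bW hD ξ w h0, smul_smul,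
      inv_mul_cancel₀ (hc ξ (by simpa using hξ)), one_smul]

end SymbolSection

/-! ### Schwartz functions and the Fourier transform -/

section Fourier
open scoped FourierTransform SchwartzMap
variable {n : ℕ}

theorem inner_stdVec (x : Rn n) (i : Fin n) : inner ℝ x (stdVec i) = x i := by
  simp [stdVec, EuclideanSpace.inner_single_right]

theorem hasTemperateGrowth_inner (m : Rn n) :
    Function.HasTemperateGrowth fun x : Rn n => inner ℝ x m := by fun_prop

/-- Multiplication of a Schwartz function by the `i`-th coordinate. -/
def coordMul (i : Fin n) (f : 𝓢(Rn n, ℂ)) : 𝓢(Rn n, ℂ) :=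
  SchwartzMap.smulLeftCLM ℂ (fun x : Rn n => inner ℝ x (stdVec i)) f

theorem coordMul_apply (i : Fin n) (f : 𝓢(Rn n, ℂ)) (x : Rn n) :
    coordMul i f x = x i • f x := by
  rw [coordMul, SchwartzMap.smulLeftCLM_apply_apply (hasTemperateGrowth_inner _), inner_stdVec]

theorem exists_iterPartial_fourierInv (L : List (Fin n)) (f : 𝓢(Rn n, ℂ)) :
    ∃ g : 𝓢(Rn n, ℂ), iterPartial L (𝓕⁻ f : 𝓢(Rn n, ℂ)) = (𝓕⁻ g : 𝓢(Rn n, ℂ)) ∧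
      ∀ ξ, g ξ = (2 * Real.pi * Complex.I) ^ L.length * ((L.map fun i => ξ i).prod : ℝ) * f ξ := by
  induction L generalizing f with
  | nil => exact ⟨f, rfl, by simp⟩
  | cons i L ih =>
    obtain ⟨g, hg, hg'⟩ := ih ((2 * Real.pi * Complex.I) • coordMul i f)
    refine ⟨g, ?_, fun ξ => ?_⟩
    · rw [← hg, iterPartial, coordMul, ← SchwartzMap.lineDerivOp_fourierInv_eq]
      rfl
    · rw [hg', smul_apply, coordMul_apply]
      simp only [List.map_cons, List.prod_cons, List.length_cons, Complex.real_smul, smul_eq_mul,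
        Complex.ofReal_mul]
      ring

theorem iterPartial_clm_comp {E F : Type*} [NormedAddCommGroup E] [NormedSpace ℝ E]
    [NormedAddCommGroup F] [NormedSpace ℝ F] (T : E →L[ℝ] F) (L : List (Fin n)) {G : Rn n → E}
    (hG : ContDiff ℝ ∞ G) : iterPartial L (fun x => T (G x)) = fun x => T (iterPartial L G x) := by
  induction L generalizing G with
  | nil => rfl
  | cons i L ih =>
    rw [iterPartial, iterPartial, ← ih (contDiff_partial hG _)]
    congr 1 with x
    have := T.hasFDerivAt.comp x (hG.differentiable (by simp) x).hasFDerivAt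
    have h2 : fderiv ℝ (fun x => T (G x)) x = T.comp (fderiv ℝ G x) := this.fderiv
    rw [h2]
    rfl

theorem iterPartial_sum {ι F : Type*} [NormedAddCommGroup F] [NormedSpace ℝ F] (s : Finset ι)
    (L : List (Fin n)) {G : ι → Rn n → F} (hG : ∀ i, ContDiff ℝ ∞ (G i)) :
    iterPartial L (fun x => ∑ i ∈ s, G i x) = fun x => ∑ i ∈ s, iterPartial L (G i) x := by
  induction L generalizing G with
  | nil => rfl
  | cons i L ih =>
    simp only [iterPartial]
    rw [← ih fun j => contDiff_partial (hG j) _]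
    congr 1 with x
    rw [fderiv_fun_sum fun j _ => (hG j).differentiable (by simp) x]
    simp

/-- The function `-ξ · ∇χ(ξ)`. -/
def negRadialDeriv (χ : 𝓢(Rn n, ℂ)) : 𝓢(Rn n, ℂ) :=
  (n : ℂ) • χ - ∑ i, ∂_{stdVec i} (coordMul i χ)

theorem negRadialDeriv_eventuallyEq_zero {χ : 𝓢(Rn n, ℂ)} {ξ : Rn n} {a : ℂ}
    (h : ∀ᶠ η in nhds ξ, χ η = a) : negRadialDeriv χ ξ = 0 := by
  have h1 : ∀ i, ∂_{stdVec i} (coordMul i χ) ξ = a := by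
    intro i
    have h2 : (coordMul i χ : Rn n → ℂ) =ᶠ[nhds ξ] fun η => inner ℝ η (stdVec i) • a := by
      filter_upwards [h] with η hη
      rw [coordMul_apply, hη, inner_stdVec]
    rw [SchwartzMap.lineDerivOp_apply_eq_fderiv, h2.fderiv_eq]
    have h3 : HasFDerivAt (fun η : Rn n => inner ℝ η (stdVec i) • a) _ ξ :=
      ((innerSL ℝ).flip (stdVec i)).hasFDerivAt.smul_const a
    rw [h3.fderiv]
    have h4 : innerSL ℝ (stdVec i) (stdVec i) = (1 : ℝ) := by
      rw [innerSL_apply_apply, inner_stdVec]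
      simp [stdVec]
    simp [h4]
  rw [negRadialDeriv, sub_apply, smul_apply, sum_apply]
  simp [h1, h.self_of_nhds]

/-- The Fourier transform exchanges ∂ᵢ and multiplication by the i-th coordinate, so -ξ·∇χ = nχ - Σ
∂ᵢ(ξᵢχ) turns into the divergence of x 𝓕⁻¹χ. -/
theorem fourierInv_negRadialDeriv (χ : 𝓢(Rn n, ℂ)) (x : Rn n) :
    (𝓕⁻ (negRadialDeriv χ) : 𝓢(Rn n, ℂ)) x =
      n * (𝓕⁻ χ : 𝓢(Rn n, ℂ)) x + fderiv ℝ (𝓕⁻ χ : 𝓢(Rn n, ℂ)) x x := by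
  have h1 : ∀ i, (𝓕⁻ (∂_{stdVec i} (coordMul i χ)) : 𝓢(Rn n, ℂ)) x =
      -(x i • fderiv ℝ (𝓕⁻ χ : 𝓢(Rn n, ℂ)) x (stdVec i)) := by
    intro i
    rw [← SchwartzMap.lineDerivOp_apply_eq_fderiv, SchwartzMap.lineDerivOp_fourierInv_eq,
      SchwartzMap.fourierInv_lineDerivOp_eq, smul_apply,
      SchwartzMap.smulLeftCLM_apply_apply (hasTemperateGrowth_inner _), inner_stdVec,
      FourierTransform.fourierInv_smul, smul_apply, neg_smul, smul_comm]
    rfl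
  have h2 : (𝓕⁻ (negRadialDeriv χ) : 𝓢(Rn n, ℂ)) =
      (n : ℂ) • (𝓕⁻ χ : 𝓢(Rn n, ℂ)) - ∑ i, (𝓕⁻ (∂_{stdVec i} (coordMul i χ)) : 𝓢(Rn n, ℂ)) := by
    have := map_sub (FourierTransform.fourierInvCLM ℂ 𝓢(Rn n, ℂ)) ((n : ℂ) • χ)
      (∑ i, ∂_{stdVec i} (coordMul i χ))
    rw [map_smul, map_sum] at this
    exact this
  rw [h2, sub_apply, smul_apply, sum_apply]
  simp only [h1, Finset.sum_neg_distrib, sub_neg_eq_add, smul_eq_mul]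
  congr 1
  have hx : x = ∑ i, x i • stdVec i := by
    ext j
    simp [stdVec, Pi.single_apply]
  conv_rhs => arg 2; rw [hx]
  rw [map_sum]
  simp only [map_smul]

theorem exists_schwartz_cutoff (n : ℕ) :
    ∃ χ : 𝓢(Rn n, ℂ), HasCompactSupport χ ∧ ∀ᶠ ξ in nhds (0 : Rn n), χ ξ = 1 := by
  let b : ContDiffBump (0 : Rn n) := ⟨1, 2, one_pos, one_lt_two⟩
  have hc : HasCompactSupport fun ξ : Rn n => (b ξ : ℂ) :=
    b.hasCompactSupport.comp_left Complex.ofReal_zero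
  have hs : ContDiff ℝ ∞ fun ξ : Rn n => (b ξ : ℂ) := Complex.ofRealCLM.contDiff.comp b.contDiff
  refine ⟨hc.toSchwartzMap hs, hc, ?_⟩
  filter_upwards [b.eventuallyEq_one] with ξ hξ
  change (b ξ : ℂ) = 1
  rw [hξ, Pi.one_apply, Complex.ofReal_one]

theorem integral_fourierInv (χ : 𝓢(Rn n, ℂ)) : ∫ x, (𝓕⁻ χ : 𝓢(Rn n, ℂ)) x = χ 0 := by
  have h : (𝓕 (𝓕⁻ χ : 𝓢(Rn n, ℂ)) : 𝓢(Rn n, ℂ)) = χ := FourierTransform.fourier_fourierInv_eq χ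
  conv_rhs => rw [← h, SchwartzMap.fourier_coe, Real.fourier_eq]
  simp

end Fourier

/-! ### Real, vector-valued kernels -/

section RealFourier
open scoped FourierTransform SchwartzMap
variable {n k : ℕ} {V W : Type*} [NormedAddCommGroup V] [NormedSpace ℝ V]
  [NormedAddCommGroup W] [NormedSpace ℝ W]

/-- The Schwartz function `∑ⱼ Re (𝓕⁻ gⱼ) bⱼ`. -/
def realFourierInv {ι : Type*} [Fintype ι] (b : ι → V) (g : ι → 𝓢(Rn n, ℂ)) : 𝓢(Rn n, V) :=
  ∑ j, SchwartzMap.postcompCLM (Complex.reCLM.smulRight (b j)) (𝓕⁻ (g j) : 𝓢(Rn n, ℂ))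

theorem iterPartial_realFourierInv {ι : Type*} [Fintype ι] (b : ι → V) (g : ι → 𝓢(Rn n, ℂ))
    (L : List (Fin n)) (x : Rn n) : iterPartial L (realFourierInv b g) x =
      ∑ j, (iterPartial L (𝓕⁻ (g j) : 𝓢(Rn n, ℂ)) x).re • b j := by
  have h : (realFourierInv b g : Rn n → V) = fun x => ∑ j ∈ Finset.univ,
      (fun y => Complex.reCLM.smulRight (b j) ((𝓕⁻ (g j) : 𝓢(Rn n, ℂ)) y)) x := by
    ext x
    rw [realFourierInv, sum_apply]
    rfl
  have hs : ∀ j, ContDiff ℝ ∞ fun y : Rn n =>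
      Complex.reCLM.smulRight (b j) ((𝓕⁻ (g j) : 𝓢(Rn n, ℂ)) y) := fun j =>
    (Complex.reCLM.smulRight (b j)).contDiff.comp ((𝓕⁻ (g j) : 𝓢(Rn n, ℂ)).smooth ⊤)
  rw [h, iterPartial_sum _ _ hs]
  simp only [iterPartial_clm_comp _ _ ((𝓕⁻ (g _) : 𝓢(Rn n, ℂ)).smooth ⊤)]
  rfl

theorem apply_symbol_eq_sum {ι : Type*} [Fintype ι] (b : Module.Basis ι ℝ V)
    (B : (Fin n → ℕ) → V →L[ℝ] W) (l : W →ₗ[ℝ] ℝ) (ξ : Rn n) (v : V) :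
    l (symbol k B ξ v) = ∑ α ∈ multiIndices n k, ∑ j,
      l (B α (b j)) * ((∏ i, ξ i ^ α i) * b.repr v j) := by
  conv_lhs => rw [← b.sum_repr v]
  simp only [symbol, sum_apply, smul_apply, map_sum, map_smul, smul_eq_mul, Finset.mul_sum]
  rw [Finset.sum_comm]
  refine Finset.sum_congr rfl fun α _ => ?_
  refine Finset.sum_congr rfl fun j _ => ?_
  ring

/-- On the Fourier side the claim is 𝔹(ξ)v(ξ)φ(ξ) = φ(ξ)w, where φ(0) = 0 covers ξ = 0. As 𝔹 has
real coefficients, real parts may be taken at the end without any symmetry of φ. -/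
theorem sum_iterPartial_realFourierInv {ι : Type*} [Fintype ι] [FiniteDimensional ℝ W]
    (b : Module.Basis ι ℝ V)
    (B : (Fin n → ℕ) → V →L[ℝ] W) {v : Rn n → V} {w : W} {φ : 𝓢(Rn n, ℂ)} (hφ : φ 0 = 0)
    (hv : ∀ ξ : Rn n, ξ ≠ 0 → symbol k B ξ (v ξ) = w) {g : ι → 𝓢(Rn n, ℂ)}
    (hg : ∀ j ξ, g j ξ = ((2 * Real.pi * Complex.I) ^ k)⁻¹ * (b.repr (v ξ) j : ℝ) * φ ξ)
    (x : Rn n) :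
    ∑ α ∈ multiIndices n k, B α (iterPartial (multiIndexList α) (realFourierInv b g) x) =
      ((𝓕⁻ φ : 𝓢(Rn n, ℂ)) x).re • w := by
  choose G hG hG' using fun (α : Fin n → ℕ) (j : ι) =>
    exists_iterPartial_fourierInv (multiIndexList α) (g j)
  simp only [iterPartial_realFourierInv, hG, map_sum, map_smul]
  refine (Module.finBasis ℝ W).ext_elem fun i => ?_
  set l : W →ₗ[ℝ] ℝ := (Module.finBasis ℝ W).coord i with hl
  change l _ = l _
  simp only [map_sum, map_smul, smul_eq_mul]
  have h1 : ∑ α ∈ multiIndices n k, ∑ j, ((l (B α (b j)) : ℝ) : ℂ) • G α j =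
      ((l w : ℝ) : ℂ) • φ := by
    ext ξ
    have h2 : ∀ α ∈ multiIndices n k, ∀ j, ((l (B α (b j)) : ℝ) : ℂ) * G α j ξ =
        ((l (B α (b j)) * ((∏ i, ξ i ^ α i) * b.repr (v ξ) j) : ℝ) : ℂ) * φ ξ := by
      intro α hα j
      rw [hG', hg, length_multiIndexList_of_mem hα, prod_map_multiIndexList]
      have : (2 * Real.pi * Complex.I : ℂ) ^ k ≠ 0 := pow_ne_zero _ Complex.two_pi_I_ne_zero
      push_cast
      field_simp
    simp only [sum_apply, smul_apply, smul_eq_mul]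
    rw [Finset.sum_congr rfl fun α hα => Finset.sum_congr rfl fun j _ => h2 α hα j]
    simp only [← Finset.sum_mul, ← Complex.ofReal_sum]
    rw [← apply_symbol_eq_sum]
    by_cases hξ : ξ = 0
    · simp [hξ, hφ]
    · rw [hv ξ hξ]
  have h3 := congrArg (FourierTransform.fourierInvCLM ℂ 𝓢(Rn n, ℂ)) h1
  simp only [map_sum, map_smul, FourierTransform.fourierInvCLM_apply] at h3
  have h4 := congrArg (fun f : 𝓢(Rn n, ℂ) => (f x).re) h3
  simp only [sum_apply, smul_apply, smul_eq_mul, Complex.re_sum, Complex.re_ofReal_mul] at h4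
  rw [mul_comm, ← h4]
  exact Finset.sum_congr rfl fun α _ => Finset.sum_congr rfl fun j _ => mul_comm _ _

end RealFourier

/-! ### The Schwartz kernel K -/

section Kernel
open scoped FourierTransform SchwartzMap
variable {n k : ℕ} {V W : Type*} [NormedAddCommGroup V] [NormedSpace ℝ V] [FiniteDimensional ℝ V]
  [NormedAddCommGroup W] [NormedSpace ℝ W] [FiniteDimensional ℝ W]

theorem exists_schwartz_of_contDiffOn {a : Rn n → ℝ} (ha : ContDiffOn ℝ ∞ a {0}ᶜ) (c : ℂ)
    {φ : 𝓢(Rn n, ℂ)} (hφ : HasCompactSupport φ) (hφ0 : ∀ᶠ ξ in nhds (0 : Rn n), φ ξ = 0) :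
    ∃ g : 𝓢(Rn n, ℂ), ∀ ξ, g ξ = c * a ξ * φ ξ := by
  have hc : HasCompactSupport fun ξ => c * a ξ * φ ξ := hφ.mul_left
  refine ⟨hc.toSchwartzMap (contDiff_iff_contDiffAt.2 fun ξ => ?_), fun _ => rfl⟩
  by_cases hξ : ξ = 0
  · subst hξ
    have : (fun ξ => c * a ξ * φ ξ) =ᶠ[nhds 0] fun _ => 0 := by
      filter_upwards [hφ0] with η hη
      rw [hη, mul_zero]
    exact contDiffAt_const.congr_of_eventuallyEq this
  · have h1 : ContDiffAt ℝ ∞ a ξ := ha.contDiffAt (isOpen_compl_singleton.mem_nhds hξ)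
    exact (contDiffAt_const.mul (Complex.ofRealCLM.contDiff.contDiffAt.comp ξ h1)).mul
      (φ.smooth ⊤).contDiffAt

theorem exists_schwartz_kernel (hn : 1 ≤ n) {B : (Fin n → ℕ) → V →L[ℝ] W}
    (hB : IsConstantRank k B) {w : W} (hw : w ∈ commonRange k B) :
    ∃ (K : 𝓢(Rn n, V)) (X : 𝓢(Rn n, ℝ)), ∫ x, X x = 1 ∧
      ∀ x, ∑ α ∈ multiIndices n k, B α (iterPartial (multiIndexList α) K x) =
        radialDiv X x • w := by
  obtain ⟨v, hv, hvw⟩ := exists_contDiffOn_symbol_eq hn hB hw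
  obtain ⟨χ, hχ, hχ1⟩ := exists_schwartz_cutoff n
  set b := Module.finBasis ℝ V
  -- Since φ vanishes wherever χ is locally constant, it is supported away from both 0 and infinity;
  -- this absorbs the singularity of v at 0.
  have hφ : HasCompactSupport (negRadialDeriv χ) := by
    refine hχ.mono' fun ξ hξ => ?_
    by_contra h
    exact hξ (negRadialDeriv_eventuallyEq_zero (notMem_tsupport_iff_eventuallyEq.1 h))
  have hφ0 : ∀ᶠ ξ in nhds (0 : Rn n), negRadialDeriv χ ξ = 0 :=
    hχ1.eventually_nhds.mono fun ξ h => negRadialDeriv_eventuallyEq_zero h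
  have hsmooth : ∀ j, ContDiffOn ℝ ∞ (fun ξ => b.repr (v ξ) j) {0}ᶜ := fun j =>
    (b.coord j).toContinuousLinearMap.contDiff.comp_contDiffOn hv
  choose g hg using fun j =>
    exists_schwartz_of_contDiffOn (hsmooth j) (((2 * Real.pi * Complex.I) ^ k)⁻¹) hφ hφ0
  refine ⟨realFourierInv b g, SchwartzMap.postcompCLM Complex.reCLM (𝓕⁻ χ : 𝓢(Rn n, ℂ)), ?_,
    fun x => ?_⟩
  · have h1 := Complex.reCLM.integral_comp_comm (𝓕⁻ χ : 𝓢(Rn n, ℂ)).integrable (μ := volume)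
    rw [integral_fourierInv, hχ1.self_of_nhds] at h1
    simpa using h1
  · rw [sum_iterPartial_realFourierInv b B hφ0.self_of_nhds hvw hg, fourierInv_negRadialDeriv]
    have h2 := Complex.reCLM.hasFDerivAt.comp x (𝓕⁻ χ : 𝓢(Rn n, ℂ)).differentiableAt.hasFDerivAt
    have h3 : fderiv ℝ (SchwartzMap.postcompCLM Complex.reCLM (𝓕⁻ χ : 𝓢(Rn n, ℂ))) x =
        Complex.reCLM.comp (fderiv ℝ (𝓕⁻ χ : 𝓢(Rn n, ℂ)) x) := h2.fderiv
    rw [radialDiv, h3]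
    simp

end Kernel

/-! ### Homogeneous solutions and the main theorem -/

theorem exists_homogeneous_fundamental_solution {n k : ℕ} {V W : Type*} [NormedAddCommGroup V]
    [NormedSpace ℝ V] [FiniteDimensional ℝ V] [NormedAddCommGroup W] [NormedSpace ℝ W]
    [FiniteDimensional ℝ W] (hn : 1 ≤ n) (hk : 1 ≤ k) {B : (Fin n → ℕ) → V →L[ℝ] W}
    (hB : IsConstantRank k B) {w : W} (hw : w ∈ commonRange k B) (hw0 : w ≠ 0) :
    ∃ u : Rn n → V, LocallyIntegrable u ∧ diffOp k B (regularDistribution u) = diracVec w ∧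
      ContDiffOn ℝ ∞ u {0}ᶜ ∧ ∀ l : ℕ, max 0 ((k : ℤ) - n + 1) ≤ (l : ℤ) →
        IsHomogeneousAwayFromZero ((k : ℤ) - n - l) (iteratedFDeriv ℝ l u) := by
  obtain ⟨K, X, hX, hK⟩ := exists_schwartz_kernel hn hB hw
  -- Truncated subtraction makes N = max(0, k-n+1), exactly the threshold for l; for n > k it is 0
  -- and P = 0.
  obtain ⟨P, hP, hPN, hPK⟩ := exists_taylorPolynomial (k + 1 - n) (K.smooth ⊤)
  obtain ⟨h1, h2⟩ := diffOp_dilatePotential hn hk (by omega) (by omega) B K hP hPN hPK X hX hw0 hK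
  refine ⟨_, h1, h2, contDiffOn_dilatePotential hP hPK (by omega), fun l hl => ?_⟩
  have h3 := isHomogeneous_iteratedFDeriv_dilatePotential (e := (n : ℤ) - k - 1) (l := l)
    hP hPN hPK (by omega) (by omega)
  convert h3 using 1
  ring

end ConstRank

end

theorem mainTheorem5 {V W : Type*}
    [NormedAddCommGroup V] [InnerProductSpace ℝ V] [FiniteDimensional ℝ V]
    [NormedAddCommGroup W] [InnerProductSpace ℝ W] [FiniteDimensional ℝ W]
    (n k : ℕ) (hn : 1 ≤ n) (hk : 1 ≤ k)
    (B : (Fin n → ℕ) → V →L[ℝ] W) (hB : ConstRank.IsConstantRank k B) :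
    (ConstRank.IsCanceling k B ↔
      ∀ (u : ConstRank.Rn n → V) (w : W), LocallyIntegrable u →
        ConstRank.diffOp k B (ConstRank.regularDistribution u) = ConstRank.diracVec w → w = 0) ∧
    (¬ ConstRank.IsCanceling k B →
      ∀ w ∈ ConstRank.commonRange k B, w ≠ 0 →
        ∃ u : ConstRank.Rn n → V,
          LocallyIntegrable u ∧
          ConstRank.diffOp k B (ConstRank.regularDistribution u) = ConstRank.diracVec w ∧
          ContDiffOn ℝ ∞ u {0}ᶜ ∧
          ∀ l : ℕ, max 0 ((k : ℤ) - n + 1) ≤ (l : ℤ) →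
            ConstRank.IsHomogeneousAwayFromZero ((k : ℤ) - n - l) (iteratedFDeriv ℝ l u)) := by
  have key : ∀ w ∈ ConstRank.commonRange k B, w ≠ 0 → _ := fun w hw hw0 =>
    ConstRank.exists_homogeneous_fundamental_solution hn hk hB hw hw0
  refine ⟨⟨fun hc u w _ hu => ?_, fun h => ?_⟩, fun _ => key⟩
  · have hw := ConstRank.mem_commonRange_of_diffOp_eq_diracVec hn hB _ hu
    rw [hc] at hw
    exact (Submodule.mem_bot ℝ).1 hw
  · refine (Submodule.eq_bot_iff _).2 fun w hw => ?_
    by_contra hw0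
    obtain ⟨u, hu, hu', -⟩ := key w hw hw0
    exact hw0 (h u w hu hu')
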